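/- Let $k\in\mathbb N$ and $\varepsilon>0$, and let $p=p(n)\in[0,1]$ be a function with $n^{-1/2}\ll p=o(1)$, that is, $n^{-1/2}/p(n)\to 0$ and $p(n)\to 0$ as $n\to\infty$. Let $G(n,p)$ denote the binomial random graph on $n$ vertices, in which each pair of vertices is an edge independently with probability $p$. Then, with probability tending to $1$ as $n\to\infty$, there exists a (not necessarily induced or spanning) subgraph $G\subset G(n,p)$ such that $$v(G)\le \varepsilon/p,\qquad \chi(G)\ge k\qquad\text{and}\qquad \mathrm{girth}(G)\ge k,$$ and moreover, for every pair $A,B\subset V(G)$ of disjoint vertex sets, each of size at least $\varepsilon\, v(G)$, the graph $G$ contains an edge between $A$ and $B$. Here $v(G)=|V(G)|$ is the number of vertices of $G$, $\chi(G)$ is its chromatic number, and $\mathrm{girth}(G)$ is the length of its shortest cycle ($\infty$ if $G$ has no cycle). -/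

import Mathlib

open Filter Topology Asymptotics

open MeasureTheory ProbabilityTheory unitInterval

namespace SimpleGraph

/-! ### Independence of edges and the sequential revealing of pairs -/

section Probability

variable {V : Type*} [Finite V] {p : I}

/-! Vertices are chosen adaptively, so that the chosen graph has a large constant back-degree
although `p` times the number `v` of chosen vertices is only a small constant. Put `v ≈ δ / p`.
Since `v ^ 2 ≤ n`, there is room for `v` disjoint blocks of `v` candidates. From each block, pick
the first candidate with at least `D` neighbours among the vertices picked before (no demand is made
in the first `s ≈ δ v / 4` blocks). A candidate succeeds with probability at least a constant `c >
0`, because `v p` is bounded below; hence all blocks succeed except with probability at most `v (1 -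
c) ^ v`.

The pairs between a block and the earlier blocks are fresh when the block is examined, so
conditional bounds multiply along the process (`binomialRandom_real_picked_le`), and conditioning on
success costs at most a factor `1 / c`. Two consequences follow.

Expansion: `D` neighbours among the earlier picks miss a given set of `s` of them with conditional
probability at most `2 (1 - s / v) ^ D`. If `D` is large, the `s`-th power of this beats the at most
`4 ^ v` pairs of index sets (`binomialRandom_real_picked_not_adj_le`).

Sparsity: a prescribed set of `m` edges is present with probability at most `(p / c) ^ m`
(`binomialRandom_real_picked_adj_le`), so the expected number of short closed trails is bounded in
terms of `c` and `k` alone. By Markov there are usually at most `v / 2` of them, and deleting one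
vertex from each leaves girth at least `k` and at least `v / 2` vertices. Expansion survives the
deletion and bounds the chromatic number, since a large colour class would contain two large sets
with no edge between them (`exists_subgraph_of_picked`). -/

instance instDiscreteMeasurableSpaceOfFinite : DiscreteMeasurableSpace (SimpleGraph V) := by
  have : MeasurableSingletonClass (SimpleGraph V) := by
    refine ⟨fun G => ?_⟩
    have h : MeasurableSet (edgeSet ⁻¹' {G.edgeSet}) :=
      measurable_edgeSet (V := V) (measurableSet_singleton _)
    have h' : edgeSet ⁻¹' {G.edgeSet} = {G} := by
      ext H; simp
    rwa [h'] at h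
  infer_instance

variable (V p) in
lemma binomialRandom_eq_map_infinitePi :
    binomialRandom V p = (Measure.infinitePi fun e : Sym2 V ↦
      toNNReal p • Measure.dirac (e ∈ (Sym2.diagSetᶜ : Set (Sym2 V))) +
        toNNReal (σ p) • Measure.dirac False).map (fun q : Sym2 V → Prop => fromEdgeSet {e | q e}) := by
  rw [binomialRandom_eq_map, setBernoulli_eq_map, Measure.map_map measurable_fromEdgeSet]
  · rfl
  · exact MeasurableEquiv.setOfPred.measurable

variable (V p) in
lemma iIndepFun_mem_edgeSet :
    iIndepFun (fun (e : Sym2 V) (Γ : SimpleGraph V) => e ∈ Γ.edgeSet) (binomialRandom V p) := by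
  have hm : Measurable (fun q : Sym2 V → Prop => (fromEdgeSet {e | q e} : SimpleGraph V)) :=
    measurable_fromEdgeSet.comp MeasurableEquiv.setOfPred.measurable
  rw [binomialRandom_eq_map_infinitePi]
  have h := iIndepFun_infinitePi (P := fun e : Sym2 V ↦
      toNNReal p • Measure.dirac (e ∈ (Sym2.diagSetᶜ : Set (Sym2 V))) +
        toNNReal (σ p) • Measure.dirac False)
      -- `fromEdgeSet` discards diagonal pairs, so each coordinate is masked accordingly.
      (X := fun (e : Sym2 V) (q : Prop) => q ∧ ¬ e.IsDiag) (fun e => by fun_prop)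
  rw [iIndepFun_iff_measure_inter_preimage_eq_mul] at h ⊢
  intro S sets hs
  rw [Measure.map_apply hm .of_discrete]
  rw [Finset.prod_congr rfl fun e _ => Measure.map_apply hm .of_discrete]
  convert h S hs using 2
  · ext q; simp
  · congr 1; ext q; simp

lemma binomialRandom_real_mem_edgeSet {e : Sym2 V} (he : ¬ e.IsDiag) :
    (binomialRandom V p).real {Γ | e ∈ Γ.edgeSet} = p := by
  have hm : Measurable (fun q : Sym2 V → Prop => (fromEdgeSet {e | q e} : SimpleGraph V)) :=
    measurable_fromEdgeSet.comp MeasurableEquiv.setOfPred.measurable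
  rw [binomialRandom_eq_map_infinitePi, map_measureReal_apply hm .of_discrete]
  have : (fun q : Sym2 V → Prop => (fromEdgeSet {e | q e} : SimpleGraph V)) ⁻¹'
      {Γ | e ∈ Γ.edgeSet} = (cylinder {e} {fun _ => True} : Set (Sym2 V → Prop)) := by
    ext q; simp [he, funext_iff]
  rw [this, measureReal_def, Measure.infinitePi_cylinder _ .of_discrete]
  simp [he]

/-- The event `A` depends only on which elements of `S` are edges of the graph. -/
def EdgeDetermined (S : Set (Sym2 V)) (A : Set (SimpleGraph V)) : Prop :=
  ∀ Γ Γ' : SimpleGraph V, (∀ e ∈ S, e ∈ Γ.edgeSet ↔ e ∈ Γ'.edgeSet) → Γ ∈ A → Γ' ∈ A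

lemma EdgeDetermined.measureReal_inter {S T : Set (Sym2 V)} {A B : Set (SimpleGraph V)}
    (hA : EdgeDetermined S A) (hB : EdgeDetermined T B) (hST : Disjoint S T) :
    (binomialRandom V p).real (A ∩ B) =
      (binomialRandom V p).real A * (binomialRandom V p).real B := by
  classical
  have hind := (iIndepFun_mem_edgeSet V p).indepFun_finset S.toFinite.toFinset T.toFinite.toFinset
    (by simpa using hST) (fun _ => .of_discrete)
  -- An event determined by `S` is a preimage under restriction to `S`, which is the form
  -- independence of disjoint families of coordinates requires.
  have key : ∀ {S : Set (Sym2 V)} {A : Set (SimpleGraph V)}, EdgeDetermined S A →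
      A = (fun (Γ : SimpleGraph V) (e : S.toFinite.toFinset) => (e : Sym2 V) ∈ Γ.edgeSet) ⁻¹'
        ((fun (Γ : SimpleGraph V) (e : S.toFinite.toFinset) => (e : Sym2 V) ∈ Γ.edgeSet) '' A) := by
    intro S A hA
    refine Set.Subset.antisymm (Set.subset_preimage_image _ _) ?_
    rintro Γ ⟨Γ', hΓ', h⟩
    refine hA Γ' Γ (fun e he => ?_) hΓ'
    simpa using congrFun h ⟨e, by simpa using he⟩
  rw [key hA, key hB, measureReal_def, hind.measure_inter_preimage_eq_mul _ _
    .of_discrete .of_discrete, ENNReal.toReal_mul]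
  rfl

/-- Revealing the edges in `S` first and the edges in `T` afterwards. -/
lemma measureReal_reveal_le {S T : Set (Sym2 V)} (hST : Disjoint S T) {A : Set (SimpleGraph V)}
    (hA : EdgeDetermined S A) {Ψ : SimpleGraph V → SimpleGraph V → Prop} {c : ℝ}
    (hS : ∀ Γ Γ' Δ, (∀ e ∈ S, e ∈ Γ.edgeSet ↔ e ∈ Γ'.edgeSet) → Ψ Γ Δ → Ψ Γ' Δ)
    (hT : ∀ Γ, EdgeDetermined T {Δ | Ψ Γ Δ})
    (hc : ∀ Γ ∈ A, (binomialRandom V p).real {Δ | Ψ Γ Δ} ≤ c) :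
    (binomialRandom V p).real {Γ | Γ ∈ A ∧ Ψ Γ Γ} ≤ (binomialRandom V p).real A * c := by
  classical
  have := Fintype.ofFinite V
  set μ := binomialRandom V p
  -- Condition on the trace on `S`: the atoms of `r` partition `A`, and on the atom of `Γ₀` the
  -- event becomes `Ψ Γ₀`, which is independent of the atom.
  let r : SimpleGraph V → Set (Sym2 V) := fun Γ => Γ.edgeSet ∩ S
  have hr : ∀ {Γ Γ'}, r Γ = r Γ' ↔ ∀ e ∈ S, e ∈ Γ.edgeSet ↔ e ∈ Γ'.edgeSet := by
    intro Γ Γ'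
    simp only [r, Set.ext_iff, Set.mem_inter_iff]
    exact forall_congr' fun e => by tauto
  let R : Finset (Set (Sym2 V)) := (r '' A).toFinite.toFinset
  have h1 : {Γ | Γ ∈ A ∧ Ψ Γ Γ} ⊆ ⋃ s ∈ R, {Γ | r Γ = s ∧ Γ ∈ A ∧ Ψ Γ Γ} := by
    intro Γ hΓ
    simp only [Set.mem_iUnion]
    exact ⟨r Γ, by simpa [R] using ⟨Γ, hΓ.1, rfl⟩, rfl, hΓ⟩
  have h2 : A = ⋃ s ∈ R, {Γ | r Γ = s} := by
    ext Γ
    simp only [Set.mem_iUnion, R, Set.Finite.mem_toFinset, Set.mem_image, Set.mem_ofPred_eq,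
      exists_prop]
    constructor
    · intro h; exact ⟨r Γ, ⟨Γ, h, rfl⟩, rfl⟩
    · rintro ⟨s, ⟨Γ', h, rfl⟩, h'⟩
      exact hA Γ' Γ (hr.1 h'.symm) h
  have h3 : μ.real A = ∑ s ∈ R, μ.real {Γ | r Γ = s} := by
    conv_lhs => rw [h2]
    refine measureReal_biUnion_finset ?_ (fun _ _ => .of_discrete)
    intro s _ t _ hst
    refine Set.disjoint_left.2 fun Γ h h' => hst ?_
    simp only [Set.mem_ofPred_eq] at h h'
    rw [← h, ← h']
  calc μ.real {Γ | Γ ∈ A ∧ Ψ Γ Γ}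
      ≤ μ.real (⋃ s ∈ R, {Γ | r Γ = s ∧ Γ ∈ A ∧ Ψ Γ Γ}) := measureReal_mono h1 (measure_ne_top _ _)
    _ ≤ ∑ s ∈ R, μ.real {Γ | r Γ = s ∧ Γ ∈ A ∧ Ψ Γ Γ} := measureReal_biUnion_finset_le _ _
    _ ≤ ∑ s ∈ R, μ.real {Γ | r Γ = s} * c := by
        refine Finset.sum_le_sum fun s hs => ?_
        obtain ⟨Γ₀, hΓ₀, rfl⟩ : s ∈ r '' A := by simpa [R] using hs
        have hdet : EdgeDetermined S {Γ | r Γ = r Γ₀} := by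
          intro Γ Γ' h h'
          exact (hr.2 h).symm.trans h'
        calc μ.real {Γ | r Γ = r Γ₀ ∧ Γ ∈ A ∧ Ψ Γ Γ}
            ≤ μ.real ({Γ | r Γ = r Γ₀} ∩ {Δ | Ψ Γ₀ Δ}) := by
              refine measureReal_mono ?_
              rintro Γ ⟨h, -, h'⟩
              exact ⟨h, hS Γ Γ₀ Γ (hr.1 h) h'⟩
          _ = μ.real {Γ | r Γ = r Γ₀} * μ.real {Δ | Ψ Γ₀ Δ} :=
              hdet.measureReal_inter (hT Γ₀) hST
          _ ≤ _ := mul_le_mul_of_nonneg_left (hc _ hΓ₀) measureReal_nonneg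
    _ = μ.real A * c := by rw [h3, Finset.sum_mul]

end Probability

/-! ### Neighbourhoods of fresh candidates in a fixed set -/

section Star

variable {V : Type*} {p : I}

open Classical in
/-- The neighbours of `w` in `Γ` that lie in `H`. -/
noncomputable def nbrIn (Γ : SimpleGraph V) (w : V) (H : Finset V) : Finset V :=
  H.filter fun u => Γ.Adj w u

lemma mem_nbrIn {Γ : SimpleGraph V} {w u : V} {H : Finset V} :
    u ∈ Γ.nbrIn w H ↔ u ∈ H ∧ Γ.Adj w u := by
  simp [nbrIn]

/-- The pairs with one element in `H` and the other in `W`. -/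
def edgesBetween (H W : Set V) : Set (Sym2 V) := {e | ∃ u ∈ H, ∃ w ∈ W, e = s(w, u)}

lemma nbrIn_congr {Γ Γ' : SimpleGraph V} {H : Finset V} {W : Set V} {w : V} (hw : w ∈ W)
    (h : ∀ e ∈ edgesBetween (H : Set V) W, e ∈ Γ.edgeSet ↔ e ∈ Γ'.edgeSet) :
    Γ.nbrIn w H = Γ'.nbrIn w H := by
  ext u
  simp only [mem_nbrIn]
  refine and_congr_right fun hu => ?_
  simpa using h s(w, u) ⟨u, hu, w, hw, rfl⟩

variable [Finite V]

lemma binomialRandom_real_nbrIn_eq {w : V} {H T : Finset V} (hw : w ∉ H) (hT : T ⊆ H) :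
    (binomialRandom V p).real {Γ | Γ.nbrIn w H = T} =
      (p : ℝ) ^ T.card * (1 - p) ^ (H.card - T.card) := by
  classical
  have hind : iIndepFun (fun (u : V) (Γ : SimpleGraph V) => s(w, u) ∈ Γ.edgeSet)
      (binomialRandom V p) :=
    (iIndepFun_mem_edgeSet V p).precomp (g := fun u : V => s(w, u))
      fun u u' h => Sym2.congr_right.1 h
  have h := hind.measure_inter_preimage_eq_mul H
    (sets := fun u => if u ∈ T then {True} else {False}) (fun _ _ => .of_discrete)
  have hset : {Γ : SimpleGraph V | Γ.nbrIn w H = T} = ⋂ u ∈ H,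
      (fun Γ : SimpleGraph V => s(w, u) ∈ Γ.edgeSet) ⁻¹' (if u ∈ T then {True} else {False}) := by
    ext Γ
    simp only [Set.mem_ofPred_eq, Finset.ext_iff, mem_nbrIn, Set.mem_iInter, Set.mem_preimage]
    constructor
    · intro h u hu
      have := h u
      by_cases huT : u ∈ T <;> simp_all
    · intro h u
      by_cases huT : u ∈ T
      · have := h u (hT huT)
        simp_all [hT huT]
      · by_cases hu : u ∈ H
        · have := h u hu
          simp_all
        · simp_all
  have hne : ∀ u ∈ H, ¬ s(w, u).IsDiag := by
    rintro u hu h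
    rw [Sym2.mk_isDiag_iff] at h
    exact hw (h ▸ hu)
  have hone : ∀ u ∈ H, (binomialRandom V p).real
      ((fun Γ : SimpleGraph V => s(w, u) ∈ Γ.edgeSet) ⁻¹' (if u ∈ T then {True} else {False})) =
      if u ∈ T then (p : ℝ) else 1 - p := by
    intro u hu
    have h1 := binomialRandom_real_mem_edgeSet (p := p) (hne u hu)
    split_ifs with huT
    · rw [← h1]; congr 1; ext Γ; simp
    · rw [← h1, ← probReal_compl_eq_one_sub .of_discrete]; congr 1; ext Γ; simp
  rw [hset, measureReal_def, h, ENNReal.toReal_prod]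
  simp only [← measureReal_def]
  rw [Finset.prod_congr rfl hone, Finset.prod_ite, Finset.prod_const, Finset.prod_const,
    Finset.filter_mem_eq_inter, Finset.inter_eq_right.2 hT, Finset.filter_notMem_eq_sdiff,
    Finset.card_sdiff_of_subset hT]

lemma binomialRandom_real_forall_adj {w : V} {T : Finset V} (hw : w ∉ T) :
    (binomialRandom V p).real {Γ | ∀ u ∈ T, Γ.Adj w u} = (p : ℝ) ^ T.card := by
  have h := binomialRandom_real_nbrIn_eq (p := p) hw subset_rfl
  simp only [Nat.sub_self, pow_zero, mul_one] at h
  rw [← h]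
  congr 1
  ext Γ
  simp [Finset.ext_iff, mem_nbrIn]

lemma binomialRandom_real_le_card_nbrIn_le {w : V} {R : Finset V} (hw : w ∉ R) (D : ℕ) :
    (binomialRandom V p).real {Γ | D ≤ (Γ.nbrIn w R).card} ≤ R.card.choose D * (p : ℝ) ^ D := by
  have h1 : {Γ : SimpleGraph V | D ≤ (Γ.nbrIn w R).card} ⊆
      ⋃ T ∈ R.powersetCard D, {Γ | ∀ u ∈ T, Γ.Adj w u} := by
    intro Γ hΓ
    obtain ⟨T, hT, hTc⟩ := Finset.exists_subset_card_eq (s := Γ.nbrIn w R) hΓ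
    simp only [Set.mem_iUnion, Finset.mem_powersetCard, exists_prop]
    exact ⟨T, ⟨fun u hu => (mem_nbrIn.1 (hT hu)).1, hTc⟩, fun u hu => (mem_nbrIn.1 (hT hu)).2⟩
  calc _ ≤ _ := measureReal_mono h1 (measure_ne_top _ _)
    _ ≤ ∑ T ∈ R.powersetCard D, (binomialRandom V p).real {Γ | ∀ u ∈ T, Γ.Adj w u} :=
      measureReal_biUnion_finset_le _ _
    _ = ∑ T ∈ R.powersetCard D, (p : ℝ) ^ D := by
      refine Finset.sum_congr rfl fun T hT => ?_
      rw [Finset.mem_powersetCard] at hT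
      rw [binomialRandom_real_forall_adj fun h => hw (hT.1 h), hT.2]
    _ = _ := by simp

/-- Exact neighbourhoods give disjoint events, so their probabilities add. This matches the union
bound above up to the factor `(1 - p) ^ H.card`. -/
lemma le_binomialRandom_real_le_card_nbrIn {w : V} {H : Finset V} (hw : w ∉ H) (D : ℕ) :
    H.card.choose D * (p : ℝ) ^ D * (1 - p) ^ H.card ≤
      (binomialRandom V p).real {Γ | D ≤ (Γ.nbrIn w H).card} := by
  have h1 : (⋃ T ∈ H.powersetCard D, {Γ : SimpleGraph V | Γ.nbrIn w H = T}) ⊆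
      {Γ | D ≤ (Γ.nbrIn w H).card} := by
    intro Γ hΓ
    simp only [Set.mem_iUnion, Finset.mem_powersetCard, exists_prop] at hΓ
    obtain ⟨T, ⟨-, hT⟩, rfl⟩ := hΓ
    exact hT.ge
  refine le_trans ?_ (measureReal_mono h1 (measure_ne_top _ _))
  rw [measureReal_biUnion_finset ?_ (fun _ _ => .of_discrete)]
  · calc _ = ∑ T ∈ H.powersetCard D, (p : ℝ) ^ D * (1 - p) ^ H.card := by simp [mul_assoc]
      _ ≤ _ := by
        refine Finset.sum_le_sum fun T hT => ?_
        rw [Finset.mem_powersetCard] at hT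
        rw [binomialRandom_real_nbrIn_eq hw hT.1, hT.2]
        refine mul_le_mul_of_nonneg_left ?_ (pow_nonneg p.2.1 _)
        exact pow_le_pow_of_le_one (by linarith [p.2.2]) (by linarith [p.2.1]) (Nat.sub_le _ _)
  · intro T _ T' _ hTT'
    refine Set.disjoint_left.2 fun Γ h h' => hTT' ?_
    simp only [Set.mem_ofPred_eq] at h h'
    rw [← h, ← h']

/-- `z` enumerates the candidates; the first one whose neighbourhood in `H` lies in `𝒢` is
selected. If every candidate satisfies `𝓕` with conditional probability at most `ρ` given `𝒢`,
so does the selected one. -/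
lemma binomialRandom_real_first_le {H : Finset V} {z : ℕ → V} {M : ℕ} (hz : Set.InjOn z (Set.Iio M))
    (hzH : ∀ b < M, z b ∉ H) {𝒢 𝓕 : Finset V → Prop} {ρ : ℝ} (hρ : 0 ≤ ρ)
    (h : ∀ b < M, (binomialRandom V p).real {Γ | 𝒢 (Γ.nbrIn (z b) H) ∧ 𝓕 (Γ.nbrIn (z b) H)} ≤
      ρ * (binomialRandom V p).real {Γ | 𝒢 (Γ.nbrIn (z b) H)}) :
    (binomialRandom V p).real {Γ | ∃ b < M, (∀ b' < b, ¬ 𝒢 (Γ.nbrIn (z b') H)) ∧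
      𝒢 (Γ.nbrIn (z b) H) ∧ 𝓕 (Γ.nbrIn (z b) H)} ≤ ρ := by
  set μ := binomialRandom V p
  let A : ℕ → Set (SimpleGraph V) := fun b => {Γ | ∀ b' < b, ¬ 𝒢 (Γ.nbrIn (z b') H)}
  have hA : ∀ b, EdgeDetermined (edgesBetween (H : Set V) (z '' Set.Iio b)) (A b) := by
    intro b Γ Γ' hΓ h b' hb'
    rw [← nbrIn_congr (Set.mem_image_of_mem z (Set.mem_Iio.2 hb')) hΓ]
    exact h b' hb'
  have hB : ∀ (b) (P : Finset V → Prop),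
      EdgeDetermined (edgesBetween (H : Set V) {z b}) {Γ | P (Γ.nbrIn (z b) H)} := by
    intro b P Γ Γ' hΓ h
    simp only [Set.mem_ofPred_eq] at h ⊢
    rwa [← nbrIn_congr (Set.mem_singleton _) hΓ]
  have hd : ∀ b < M, Disjoint (edgesBetween (H : Set V) (z '' Set.Iio b))
      (edgesBetween (H : Set V) {z b}) := by
    intro b hb
    rw [Set.disjoint_left]
    rintro _ ⟨u, hu, _, ⟨b', hb', rfl⟩, rfl⟩ ⟨u', hu', _, rfl, h⟩
    rw [Sym2.eq_iff] at h
    rcases h with ⟨h, -⟩ | ⟨h, -⟩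
    · exact (ne_of_lt hb') (hz (lt_trans hb' hb) hb h)
    · exact hzH b' (lt_trans hb' hb) (h ▸ hu')
  have h1 : {Γ | ∃ b < M, (∀ b' < b, ¬ 𝒢 (Γ.nbrIn (z b') H)) ∧
      𝒢 (Γ.nbrIn (z b) H) ∧ 𝓕 (Γ.nbrIn (z b) H)} ⊆
      ⋃ b ∈ Finset.range M, (A b ∩ {Γ | 𝒢 (Γ.nbrIn (z b) H) ∧ 𝓕 (Γ.nbrIn (z b) H)}) := by
    rintro Γ ⟨b, hb, h, h'⟩
    simp only [Set.mem_iUnion, Finset.mem_range, exists_prop]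
    exact ⟨b, hb, h, h'⟩
  -- The events that `z b` is the first success are disjoint for different `b`.
  have h2 : ∑ b ∈ Finset.range M, μ.real (A b ∩ {Γ | 𝒢 (Γ.nbrIn (z b) H)}) ≤ 1 := by
    rw [← measureReal_biUnion_finset ?_ (fun _ _ => .of_discrete)]
    · exact measureReal_le_one
    · have : ∀ b b', b < b' → Disjoint (A b ∩ {Γ | 𝒢 (Γ.nbrIn (z b) H)})
          (A b' ∩ {Γ | 𝒢 (Γ.nbrIn (z b') H)}) := by
        intro b b' hbb'
        exact Set.disjoint_left.2 fun Γ h h' => h'.1 b hbb' h.2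
      intro b _ b' _ hbb'
      rcases lt_or_gt_of_ne hbb' with h | h
      · exact this _ _ h
      · exact (this _ _ h).symm
  calc _ ≤ _ := measureReal_mono h1 (measure_ne_top _ _)
    _ ≤ _ := measureReal_biUnion_finset_le _ _
    _ ≤ ∑ b ∈ Finset.range M, ρ * μ.real (A b ∩ {Γ | 𝒢 (Γ.nbrIn (z b) H)}) := by
      refine Finset.sum_le_sum fun b hb => ?_
      rw [Finset.mem_range] at hb
      rw [(hA b).measureReal_inter (hB b fun N => 𝒢 N ∧ 𝓕 N) (hd b hb),
        (hA b).measureReal_inter (hB b 𝒢) (hd b hb)]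
      calc _ ≤ μ.real (A b) * (ρ * μ.real {Γ | 𝒢 (Γ.nbrIn (z b) H)}) :=
            mul_le_mul_of_nonneg_left (h b hb) measureReal_nonneg
        _ = _ := by ring
    _ ≤ ρ := by
      rw [← Finset.mul_sum]
      exact mul_le_of_le_one_right hρ h2

lemma binomialRandom_real_none_le {H : Finset V} {z : ℕ → V} {M : ℕ} (hz : Set.InjOn z (Set.Iio M))
    (hzH : ∀ b < M, z b ∉ H) {𝒢 : Finset V → Prop} {c : ℝ} (hc : c ≤ 1)
    (h : ∀ b < M, c ≤ (binomialRandom V p).real {Γ | 𝒢 (Γ.nbrIn (z b) H)}) :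
    (binomialRandom V p).real {Γ | ∀ b < M, ¬ 𝒢 (Γ.nbrIn (z b) H)} ≤ (1 - c) ^ M := by
  induction M with
  | zero => simp
  | succ M ih =>
    have hA : EdgeDetermined (edgesBetween (H : Set V) (z '' Set.Iio M))
        {Γ | ∀ b < M, ¬ 𝒢 (Γ.nbrIn (z b) H)} := by
      intro Γ Γ' hΓ h b' hb'
      rw [← nbrIn_congr (Set.mem_image_of_mem z (Set.mem_Iio.2 hb')) hΓ]
      exact h b' hb'
    have hB : EdgeDetermined (edgesBetween (H : Set V) {z M}) {Γ | ¬ 𝒢 (Γ.nbrIn (z M) H)} := by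
      intro Γ Γ' hΓ h
      simp only [Set.mem_ofPred_eq] at h ⊢
      rwa [← nbrIn_congr (Set.mem_singleton _) hΓ]
    have hd : Disjoint (edgesBetween (H : Set V) (z '' Set.Iio M))
        (edgesBetween (H : Set V) {z M}) := by
      rw [Set.disjoint_left]
      rintro _ ⟨u, hu, _, ⟨b', hb', rfl⟩, rfl⟩ ⟨u', hu', _, rfl, h⟩
      have hb' : b' < M := hb'
      rw [Sym2.eq_iff] at h
      rcases h with ⟨h, -⟩ | ⟨h, -⟩
      · exact (ne_of_lt hb') (hz (lt_trans hb' M.lt_succ_self) M.lt_succ_self h)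
      · exact hzH b' (lt_trans hb' M.lt_succ_self) (h ▸ hu')
    have hset : {Γ : SimpleGraph V | ∀ b < M + 1, ¬ 𝒢 (Γ.nbrIn (z b) H)} =
        {Γ | ∀ b < M, ¬ 𝒢 (Γ.nbrIn (z b) H)} ∩ {Γ | ¬ 𝒢 (Γ.nbrIn (z M) H)} := by
      ext Γ
      simp only [Set.mem_ofPred_eq, Set.mem_inter_iff]
      refine ⟨fun h => ⟨fun b hb => h b (by omega), h M (by omega)⟩, fun h b hb => ?_⟩
      rcases Nat.lt_succ_iff_lt_or_eq.1 hb with hb | rfl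
      exacts [h.1 b hb, h.2]
    rw [hset, hA.measureReal_inter hB hd, pow_succ]
    refine mul_le_mul (ih (hz.mono fun b hb => lt_trans hb M.lt_succ_self)
      (fun b hb => hzH b (by omega)) (fun b hb => h b (by omega))) ?_ measureReal_nonneg
      (pow_nonneg (by linarith) _)
    have := h M M.lt_succ_self
    have h' := probReal_compl_eq_one_sub (μ := binomialRandom V p)
      (s := {Γ | 𝒢 (Γ.nbrIn (z M) H)}) .of_discrete
    have h'' : {Γ : SimpleGraph V | ¬ 𝒢 (Γ.nbrIn (z M) H)} = {Γ | 𝒢 (Γ.nbrIn (z M) H)}ᶜ := rfl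
    rw [h'', h']
    linarith

end Star

/-! ### The selection process and its conditional probabilities -/

section Selection

variable {V : Type*} {p : I}

/-- Some candidate `z b`, `b < M`, has at least `d` neighbours in `H`. -/
def HasCandidate (Γ : SimpleGraph V) (z : ℕ → V) (M d : ℕ) (H : Finset V) : Prop :=
  ∃ b < M, d ≤ (Γ.nbrIn (z b) H).card

open Classical in
/-- The first candidate `z b`, `b < M`, with at least `d` neighbours in `H`, and `z 0` if there is
no such candidate. -/
noncomputable def pick (Γ : SimpleGraph V) (z : ℕ → V) (M d : ℕ) (H : Finset V) : V :=
  if h : Γ.HasCandidate z M d H then z (Nat.find h) else z 0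

lemma pick_mem {Γ : SimpleGraph V} {z : ℕ → V} {M d : ℕ} {H : Finset V} (hM : 0 < M) :
    Γ.pick z M d H ∈ z '' Set.Iio M := by
  classical
  unfold pick
  split_ifs with h
  · exact ⟨_, (Nat.find_spec h).1, rfl⟩
  · exact ⟨0, hM, rfl⟩

lemma HasCandidate.exists_pick_eq {Γ : SimpleGraph V} {z : ℕ → V} {M d : ℕ} {H : Finset V}
    (h : Γ.HasCandidate z M d H) : ∃ b < M, (∀ b' < b, ¬ d ≤ (Γ.nbrIn (z b') H).card) ∧
      d ≤ (Γ.nbrIn (z b) H).card ∧ Γ.pick z M d H = z b := by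
  classical
  refine ⟨Nat.find h, (Nat.find_spec h).1, fun b' hb' => ?_, (Nat.find_spec h).2, ?_⟩
  · have := Nat.find_min h hb'
    exact fun h' => this ⟨hb'.trans (Nat.find_spec h).1, h'⟩
  · unfold pick
    rw [dif_pos h]

lemma hasCandidate_congr {Γ Γ' : SimpleGraph V} {z : ℕ → V} {M d : ℕ} {H : Finset V}
    (h : ∀ b < M, Γ.nbrIn (z b) H = Γ'.nbrIn (z b) H) :
    Γ.HasCandidate z M d H ↔ Γ'.HasCandidate z M d H :=
  exists_congr fun b => and_congr_right fun hb => by rw [h b hb]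

lemma pick_congr {Γ Γ' : SimpleGraph V} {z : ℕ → V} {M d : ℕ} {H : Finset V}
    (h : ∀ b < M, Γ.nbrIn (z b) H = Γ'.nbrIn (z b) H) :
    Γ.pick z M d H = Γ'.pick z M d H := by
  classical
  unfold pick
  by_cases hc : Γ.HasCandidate z M d H
  · have hc' := (hasCandidate_congr h).1 hc
    rw [dif_pos hc, dif_pos hc']
    congr 1
    refine Nat.find_congr' fun {b} => and_congr_right fun hb => ?_
    rw [h b hb]
  · rw [dif_neg hc, dif_neg fun hc' => hc ((hasCandidate_congr h).2 hc')]

open Classical in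
/-- The set of the first `j` selected vertices: from the block `φ i 0, …, φ i (M - 1)` the first
vertex with at least `d i` neighbours among the vertices selected before is selected. -/
noncomputable def pickedSet (Γ : SimpleGraph V) (φ : ℕ → ℕ → V) (M : ℕ) (d : ℕ → ℕ) : ℕ → Finset V
  | 0 => ∅
  | j + 1 => insert (Γ.pick (φ j) M (d j) (pickedSet Γ φ M d j)) (pickedSet Γ φ M d j)

/-- The vertex selected from the `j`-th block. -/
noncomputable def picked (Γ : SimpleGraph V) (φ : ℕ → ℕ → V) (M : ℕ) (d : ℕ → ℕ) (j : ℕ) : V :=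
  Γ.pick (φ j) M (d j) (Γ.pickedSet φ M d j)

open Classical in
/-- The set of the first `j` values of `y`. -/
noncomputable def initSet (y : ℕ → V) (j : ℕ) : Finset V := (Finset.range j).image y

lemma mem_initSet {y : ℕ → V} {j : ℕ} {u : V} : u ∈ initSet y j ↔ ∃ i < j, y i = u := by
  simp [initSet]

lemma initSet_congr {y y' : ℕ → V} {j : ℕ} (h : ∀ i < j, y i = y' i) :
    initSet y j = initSet y' j := by
  ext u
  simp only [mem_initSet]
  exact exists_congr fun i => and_congr_right fun hi => by rw [h i hi]

lemma pickedSet_eq (Γ : SimpleGraph V) (φ : ℕ → ℕ → V) (M : ℕ) (d : ℕ → ℕ) (j : ℕ) :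
    Γ.pickedSet φ M d j = initSet (Γ.picked φ M d) j := by
  classical
  induction j with
  | zero => ext; simp [pickedSet, mem_initSet]
  | succ j ih =>
    rw [pickedSet]
    change insert (Γ.picked φ M d j) _ = _
    rw [ih]
    ext u
    simp only [Finset.mem_insert, mem_initSet, Nat.lt_succ_iff_lt_or_eq]
    constructor
    · rintro (rfl | ⟨i, hi, rfl⟩)
      exacts [⟨j, Or.inr rfl, rfl⟩, ⟨i, Or.inl hi, rfl⟩]
    · rintro ⟨i, hi | rfl, rfl⟩
      exacts [Or.inr ⟨i, hi, rfl⟩, Or.inl rfl]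

lemma picked_eq (Γ : SimpleGraph V) (φ : ℕ → ℕ → V) (M : ℕ) (d : ℕ → ℕ) (j : ℕ) :
    Γ.picked φ M d j = Γ.pick (φ j) M (d j) (initSet (Γ.picked φ M d) j) := by
  rw [← pickedSet_eq, picked]

lemma picked_mem {Γ : SimpleGraph V} {φ : ℕ → ℕ → V} {M : ℕ} {d : ℕ → ℕ} (hM : 0 < M) (j : ℕ) :
    Γ.picked φ M d j ∈ φ j '' Set.Iio M :=
  pick_mem hM

/-- The union of the first `j` blocks. -/
def blocks (φ : ℕ → ℕ → V) (M j : ℕ) : Set V := ⋃ i < j, φ i '' Set.Iio M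

lemma mem_blocks {φ : ℕ → ℕ → V} {M j : ℕ} {u : V} :
    u ∈ blocks φ M j ↔ ∃ i < j, u ∈ φ i '' Set.Iio M := by
  simp [blocks]

lemma initSet_subset_blocks {φ : ℕ → ℕ → V} {M j : ℕ} {y : ℕ → V}
    (hy : ∀ i < j, y i ∈ φ i '' Set.Iio M) : (initSet y j : Set V) ⊆ blocks φ M j := by
  intro u hu
  obtain ⟨i, hi, rfl⟩ := mem_initSet.1 hu
  exact mem_blocks.2 ⟨i, hi, hy i hi⟩

lemma edgesBetween_mono {H H' W W' : Set V} (hH : H ⊆ H') (hW : W ⊆ W') :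
    edgesBetween H W ⊆ edgesBetween H' W' := by
  rintro _ ⟨u, hu, w, hw, rfl⟩
  exact ⟨u, hH hu, w, hW hw, rfl⟩

/-- The pairs of vertices in the first `j` blocks. -/
def blockPairs (φ : ℕ → ℕ → V) (M j : ℕ) : Set (Sym2 V) :=
  edgesBetween (blocks φ M j) (blocks φ M j)

/-- The pairs with a vertex in block `j` and a vertex in a previous block. -/
def newPairs (φ : ℕ → ℕ → V) (M j : ℕ) : Set (Sym2 V) :=
  edgesBetween (blocks φ M j) (φ j '' Set.Iio M)

lemma newPairs_subset {φ : ℕ → ℕ → V} {M i j : ℕ} (hij : i < j) :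
    newPairs φ M i ⊆ blockPairs φ M j := by
  refine edgesBetween_mono (fun u hu => ?_) fun u hu => mem_blocks.2 ⟨i, hij, hu⟩
  obtain ⟨i', hi', h⟩ := mem_blocks.1 hu
  exact mem_blocks.2 ⟨i', hi'.trans hij, h⟩

/-- The first `v` blocks of size `M` consist of distinct vertices. -/
def DistinctBlocks (φ : ℕ → ℕ → V) (M v : ℕ) : Prop :=
  ∀ i < v, ∀ b < M, ∀ i' < v, ∀ b' < M, φ i b = φ i' b' → i = i' ∧ b = b'

lemma DistinctBlocks.notMem_blocks {φ : ℕ → ℕ → V} {M v j : ℕ} (h : DistinctBlocks φ M v)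
    (hj : j < v) {b : ℕ} (hb : b < M) : φ j b ∉ blocks φ M j := by
  intro hm
  obtain ⟨i, hi, b', hb', h'⟩ := mem_blocks.1 hm
  exact hi.ne (h i (hi.trans hj) b' hb' j hj b hb h').1

lemma DistinctBlocks.disjoint {φ : ℕ → ℕ → V} {M v j : ℕ} (h : DistinctBlocks φ M v)
    (hj : j < v) : Disjoint (blockPairs φ M j) (newPairs φ M j) := by
  rw [Set.disjoint_left]
  rintro _ ⟨u, hu, w, hw, rfl⟩ ⟨u', hu', _, ⟨b, hb, rfl⟩, h'⟩
  rw [Sym2.eq_iff] at h'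
  rcases h' with ⟨rfl, -⟩ | ⟨-, rfl⟩
  · exact h.notMem_blocks hj hb hw
  · exact h.notMem_blocks hj hb hu

lemma DistinctBlocks.injOn {φ : ℕ → ℕ → V} {M v : ℕ} (h : DistinctBlocks φ M v) {y : ℕ → V}
    (hy : ∀ i < v, y i ∈ φ i '' Set.Iio M) : Set.InjOn y (Set.Iio v) := by
  intro i hi i' hi' hii'
  obtain ⟨b, hb, hb'⟩ := hy i hi
  obtain ⟨c, hc, hc'⟩ := hy i' hi'
  exact (h i hi b hb i' hi' c hc (by rw [hb', hc', hii'])).1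

lemma DistinctBlocks.mono {φ : ℕ → ℕ → V} {M v j : ℕ} (h : DistinctBlocks φ M v) (hj : j ≤ v) :
    DistinctBlocks φ M j :=
  fun i hi b hb i' hi' b' hb' => h i (hi.trans_le hj) b hb i' (hi'.trans_le hj) b' hb'

lemma nbrIn_initSet_congr {Γ Γ' : SimpleGraph V} {φ : ℕ → ℕ → V} {M j : ℕ} {y : ℕ → V}
    (hy : ∀ i < j, y i ∈ φ i '' Set.Iio M)
    (h : ∀ e ∈ newPairs φ M j, e ∈ Γ.edgeSet ↔ e ∈ Γ'.edgeSet) {b : ℕ} (hb : b < M) :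
    Γ.nbrIn (φ j b) (initSet y j) = Γ'.nbrIn (φ j b) (initSet y j) :=
  nbrIn_congr (Set.mem_image_of_mem (φ j) (Set.mem_Iio.2 hb)) fun e he =>
    h e (edgesBetween_mono (initSet_subset_blocks hy) subset_rfl he)

/-- The choice in block `i` inspects only pairs joining block `i` to earlier blocks. Hence the
history is determined by the pairs already revealed. -/
lemma picked_congr {Γ Γ' : SimpleGraph V} {φ : ℕ → ℕ → V} {M j : ℕ} {d : ℕ → ℕ} (hM : 0 < M)
    (h : ∀ e ∈ blockPairs φ M j, e ∈ Γ.edgeSet ↔ e ∈ Γ'.edgeSet) {i : ℕ} (hi : i < j) :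
    Γ.picked φ M d i = Γ'.picked φ M d i := by
  induction i using Nat.strong_induction_on with
  | _ i ih =>
    rw [picked_eq, picked_eq, ← initSet_congr fun i' hi' => ih i' hi' (hi'.trans hi)]
    exact pick_congr fun b hb => nbrIn_initSet_congr (fun i' _ => picked_mem hM i')
      (fun e he => h e (newPairs_subset hi he)) hb

variable [Finite V]

/-- Conditional probability bounds along the selection process multiply. -/
lemma binomialRandom_real_picked_le {φ : ℕ → ℕ → V} {M v : ℕ} (d : ℕ → ℕ) (hM : 0 < M)
    (hφ : DistinctBlocks φ M v) {Φ : ℕ → (ℕ → V) → SimpleGraph V → Prop} {c : ℕ → ℝ}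
    (hc : ∀ j < v, 0 ≤ c j)
    (hΦ : ∀ j < v, ∀ y, (∀ i < j, y i ∈ φ i '' Set.Iio M) →
      (binomialRandom V p).real {Γ | Φ j y Γ} ≤ c j)
    (hy : ∀ j < v, ∀ y y' Γ, (∀ i < j, y i = y' i) → Φ j y Γ → Φ j y' Γ)
    (hT : ∀ j < v, ∀ y, (∀ i < j, y i ∈ φ i '' Set.Iio M) →
      EdgeDetermined (newPairs φ M j) {Γ | Φ j y Γ}) :
    (binomialRandom V p).real {Γ | ∀ j < v, Φ j (Γ.picked φ M d) Γ} ≤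
      ∏ j ∈ Finset.range v, c j := by
  induction v with
  | zero => simp
  | succ v ih =>
    have hA : EdgeDetermined (blockPairs φ M v) {Γ | ∀ j < v, Φ j (Γ.picked φ M d) Γ} := by
      intro Γ Γ' h hΓ j hj
      refine hy j (by omega) _ _ _ (fun i hi => picked_congr hM h (hi.trans hj)) ?_
      exact hT j (by omega) _ (fun i _ => picked_mem hM i) Γ Γ'
        (fun e he => h e (newPairs_subset hj he)) (hΓ j hj)
    have hset : {Γ : SimpleGraph V | ∀ j < v + 1, Φ j (Γ.picked φ M d) Γ} =
        {Γ | Γ ∈ {Γ : SimpleGraph V | ∀ j < v, Φ j (Γ.picked φ M d) Γ} ∧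
          Φ v (Γ.picked φ M d) Γ} := by
      ext Γ
      simp only [Set.mem_ofPred_eq]
      refine ⟨fun h => ⟨fun b hb => h b (by omega), h v (by omega)⟩, fun h b hb => ?_⟩
      rcases Nat.lt_succ_iff_lt_or_eq.1 hb with hb | rfl
      exacts [h.1 b hb, h.2]
    rw [hset, Finset.prod_range_succ]
    refine (measureReal_reveal_le (hφ.disjoint v.lt_succ_self) hA
      (Ψ := fun Γ Δ => Φ v (Γ.picked φ M d) Δ) (c := c v) ?_ ?_ ?_).trans ?_
    · intro Γ Γ' Δ h h'
      exact hy v v.lt_succ_self _ _ _ (fun i hi => picked_congr hM h hi) h'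
    · exact fun Γ => hT v v.lt_succ_self _ fun i _ => picked_mem hM i
    · exact fun Γ _ => hΦ v v.lt_succ_self _ fun i _ => picked_mem hM i
    · refine mul_le_mul_of_nonneg_right ?_ (hc v v.lt_succ_self)
      exact ih (hφ.mono v.le_succ) (fun j hj => hc j (by omega)) (fun j hj => hΦ j (by omega))
        (fun j hj => hy j (by omega)) (fun j hj => hT j (by omega))

/-- A union bound for the event that some block has no candidate. -/
lemma binomialRandom_real_exists_not_hasCandidate_le {φ : ℕ → ℕ → V} {M v : ℕ} {d : ℕ → ℕ}
    (hM : 0 < M) (hφ : DistinctBlocks φ M v) {c : ℝ} (hc : c ≤ 1)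
    (h : ∀ j < v, ∀ y, (∀ i < j, y i ∈ φ i '' Set.Iio M) → ∀ b < M,
      c ≤ (binomialRandom V p).real {Γ | d j ≤ (Γ.nbrIn (φ j b) (initSet y j)).card}) :
    (binomialRandom V p).real {Γ | ∃ j < v,
      ¬ Γ.HasCandidate (φ j) M (d j) (initSet (Γ.picked φ M d) j)} ≤ v * (1 - c) ^ M := by
  have h1 : ∀ j < v, (binomialRandom V p).real
      {Γ | ¬ Γ.HasCandidate (φ j) M (d j) (initSet (Γ.picked φ M d) j)} ≤ (1 - c) ^ M := by
    intro j hj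
    -- Only stage `j` carries a condition; all other stages contribute the factor `1`.
    have h2 := binomialRandom_real_picked_le (p := p) d hM hφ
      (Φ := fun i y Γ => i = j → ¬ Γ.HasCandidate (φ j) M (d j) (initSet y j))
      (c := fun i => if i = j then (1 - c) ^ M else 1) ?_ ?_ ?_ ?_
    · rw [Finset.prod_ite_eq' (Finset.range v) j, if_pos (Finset.mem_range.2 hj)] at h2
      refine le_trans (le_of_eq ?_) h2
      congr 1
      ext Γ
      exact ⟨fun h _ _ _ => h, fun h => h j hj rfl⟩
    · intro i _
      have : 0 ≤ 1 - c := by linarith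
      split_ifs <;> positivity
    · intro i hi y hy
      split_ifs with hij
      · subst hij
        simp only [forall_const, HasCandidate, not_exists, not_and]
        refine binomialRandom_real_none_le (z := φ i) (𝒢 := fun N => d i ≤ N.card) ?_ ?_ hc (h i hi y hy)
        · intro b hb b' hb' hbb'
          exact (hφ i hi b hb i hi b' hb' hbb').2
        · exact fun b hb hm => hφ.notMem_blocks hi hb (initSet_subset_blocks hy hm)
      · exact measureReal_le_one
    · rintro i hi y y' Γ hyy' h rfl
      rw [← initSet_congr hyy']
      exact h rfl
    · rintro i hi y hy Γ Γ' hΓ h rfl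
      rw [← hasCandidate_congr fun b hb => nbrIn_initSet_congr hy hΓ hb]
      exact h rfl
  have h3 : {Γ : SimpleGraph V | ∃ j < v,
      ¬ Γ.HasCandidate (φ j) M (d j) (initSet (Γ.picked φ M d) j)} ⊆ ⋃ j ∈ Finset.range v,
      {Γ | ¬ Γ.HasCandidate (φ j) M (d j) (initSet (Γ.picked φ M d) j)} := by
    rintro Γ ⟨j, hj, h⟩
    simp only [Set.mem_iUnion, Finset.mem_range, exists_prop]
    exact ⟨j, hj, h⟩
  calc _ ≤ _ := measureReal_mono h3 (measure_ne_top _ _)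
    _ ≤ _ := measureReal_biUnion_finset_le _ _
    _ ≤ ∑ j ∈ Finset.range v, (1 - c) ^ M :=
      Finset.sum_le_sum fun j hj => h1 j (Finset.mem_range.1 hj)
    _ = _ := by simp

/-- If a property of the neighbourhood has conditional probability at most `ρ j` for every
candidate in block `j`, then the selected vertices have it with probability at most the product. -/
lemma binomialRandom_real_forall_picked_le {φ : ℕ → ℕ → V} {M v : ℕ} {d : ℕ → ℕ} (hM : 0 < M)
    (hφ : DistinctBlocks φ M v) {𝓕 : ℕ → (ℕ → V) → Finset V → Prop} {ρ : ℕ → ℝ}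
    (hρ : ∀ j < v, 0 ≤ ρ j)
    (h𝓕 : ∀ j < v, ∀ y y' N, (∀ i < j, y i = y' i) → 𝓕 j y N → 𝓕 j y' N)
    (h : ∀ j < v, ∀ y, (∀ i < j, y i ∈ φ i '' Set.Iio M) → ∀ b < M,
      (binomialRandom V p).real {Γ | d j ≤ (Γ.nbrIn (φ j b) (initSet y j)).card ∧
        𝓕 j y (Γ.nbrIn (φ j b) (initSet y j))} ≤
      ρ j * (binomialRandom V p).real {Γ | d j ≤ (Γ.nbrIn (φ j b) (initSet y j)).card}) :
    (binomialRandom V p).real {Γ | ∀ j < v,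
      Γ.HasCandidate (φ j) M (d j) (initSet (Γ.picked φ M d) j) ∧
      𝓕 j (Γ.picked φ M d) (Γ.nbrIn (Γ.picked φ M d j) (initSet (Γ.picked φ M d) j))} ≤
      ∏ j ∈ Finset.range v, ρ j := by
  have h2 := binomialRandom_real_picked_le (p := p) d hM hφ
      (Φ := fun j y Γ => Γ.HasCandidate (φ j) M (d j) (initSet y j) ∧
        𝓕 j y (Γ.nbrIn (Γ.pick (φ j) M (d j) (initSet y j)) (initSet y j)))
      (c := ρ) hρ ?_ ?_ ?_
  · refine le_trans (le_of_eq ?_) h2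
    congr 1
    ext Γ
    simp only [Set.mem_ofPred_eq, ← picked_eq]
  · intro j hj y hy
    refine le_trans (measureReal_mono ?_ (measure_ne_top _ _)) (binomialRandom_real_first_le
      (z := φ j) (M := M) (𝒢 := fun N => d j ≤ N.card) (𝓕 := 𝓕 j y) ?_ ?_ (hρ j hj) (h j hj y hy))
    · rintro Γ ⟨hc, hF⟩
      obtain ⟨b, hb, h1, h2, h3⟩ := hc.exists_pick_eq
      exact ⟨b, hb, h1, h2, h3 ▸ hF⟩
    · intro b hb b' hb' hbb'
      exact (hφ j hj b hb j hj b' hb' hbb').2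
    · exact fun b hb hm => hφ.notMem_blocks hj hb (initSet_subset_blocks hy hm)
  · intro j hj y y' Γ hyy' h
    rw [← initSet_congr hyy']
    exact ⟨h.1, h𝓕 j hj _ _ _ hyy' h.2⟩
  · rintro j hj y hy Γ Γ' hΓ ⟨h1, h2⟩
    have hN : ∀ b < M, Γ.nbrIn (φ j b) (initSet y j) = Γ'.nbrIn (φ j b) (initSet y j) :=
      fun b hb => nbrIn_initSet_congr hy hΓ hb
    refine ⟨(hasCandidate_congr hN).1 h1, ?_⟩
    rw [← pick_congr hN]
    obtain ⟨b, hb, h⟩ := pick_mem (Γ := Γ) (z := φ j) (d := d j) (H := initSet y j) hM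
    rw [← h, ← hN b hb, h]
    exact h2

end Selection

/-! ### Estimates for prescribed edges and prescribed non-edges -/

section Bounds

/-- Compare descending factorials factor by factor: `(a - s - i) / (a - i) ≤ (a - s) / a`. -/
lemma choose_sub_mul_pow_le (a s D : ℕ) (hs : s ≤ a) :
    ((a - s).choose D : ℝ) * (a : ℝ) ^ D ≤ (a.choose D : ℝ) * ((a : ℝ) - s) ^ D := by
  have key : ((a - s).descFactorial D : ℝ) * (a : ℝ) ^ D ≤
      (a.descFactorial D : ℝ) * ((a : ℝ) - s) ^ D := by
    have hsub : ((a - s : ℕ) : ℝ) = (a : ℝ) - s := by push_cast [hs]; ring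
    have h0 : (0 : ℝ) ≤ (a : ℝ) - s := by rw [← hsub]; positivity
    induction D with
    | zero => simp
    | succ D ih =>
      rw [Nat.descFactorial_succ, Nat.descFactorial_succ, pow_succ, pow_succ]
      have h1 : (((a - s) - D : ℕ) : ℝ) * a ≤ ((a - D : ℕ) : ℝ) * ((a : ℝ) - s) := by
        rcases le_or_gt (a - s) D with h | h
        · rw [Nat.sub_eq_zero_of_le h]
          simp only [Nat.cast_zero, zero_mul]
          positivity
        · have h2 : D ≤ a := by omega
          rw [Nat.cast_sub h.le, hsub, Nat.cast_sub h2]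
          nlinarith [mul_nonneg (Nat.cast_nonneg (α := ℝ) D) (Nat.cast_nonneg (α := ℝ) s)]
      push_cast
      calc _ = ((((a - s) - D : ℕ) : ℝ) * a) * (((a - s).descFactorial D : ℝ) * (a : ℝ) ^ D) := by
            ring
        _ ≤ (((a - D : ℕ) : ℝ) * ((a : ℝ) - s)) *
            ((a.descFactorial D : ℝ) * ((a : ℝ) - s) ^ D) := by
            refine mul_le_mul h1 ih (by positivity) (by positivity)
        _ = _ := by ring
  rw [Nat.descFactorial_eq_factorial_mul_choose, Nat.descFactorial_eq_factorial_mul_choose] at key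
  push_cast at key
  have hD : (0 : ℝ) < (D.factorial : ℝ) := by positivity
  refine le_of_mul_le_mul_left ?_ hD
  linarith

variable {V : Type*} {p : I}

lemma card_initSet {φ : ℕ → ℕ → V} {M v j : ℕ} (hφ : DistinctBlocks φ M v) (hj : j < v)
    {y : ℕ → V} (hy : ∀ i < j, y i ∈ φ i '' Set.Iio M) : (initSet y j).card = j := by
  classical
  rw [initSet, Finset.card_image_of_injOn, Finset.card_range]
  simpa using (hφ.mono hj.le).injOn hy

variable [Finite V]

/-- The factor `1 / 2` is Bernoulli's inequality: `(1 - p) ^ j ≥ 1 - j p ≥ 1 / 2`. -/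
lemma le_binomialRandom_real_initSet {φ : ℕ → ℕ → V} {M v j : ℕ} (hφ : DistinctBlocks φ M v)
    (hpv : v * (p : ℝ) ≤ 1 / 2) (hj : j < v) {y : ℕ → V} (hy : ∀ i < j, y i ∈ φ i '' Set.Iio M)
    {b : ℕ} (hb : b < M) (D : ℕ) :
    (j.choose D : ℝ) * (p : ℝ) ^ D / 2 ≤
      (binomialRandom V p).real {Γ | D ≤ (Γ.nbrIn (φ j b) (initSet y j)).card} := by
  have h1 := le_binomialRandom_real_le_card_nbrIn (p := p) (w := φ j b) (H := initSet y j)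
    (fun hm => hφ.notMem_blocks hj hb (initSet_subset_blocks hy hm)) D
  rw [card_initSet hφ hj hy] at h1
  refine le_trans ?_ h1
  have hp0 : (0 : ℝ) ≤ p := p.2.1
  have hp1 : (p : ℝ) ≤ 1 := p.2.2
  have h2 : (1 : ℝ) / 2 ≤ (1 - p) ^ j := by
    have := one_add_mul_le_pow (a := -(p : ℝ)) (by linarith) j
    have hjv : (j : ℝ) * p ≤ v * p := mul_le_mul_of_nonneg_right (by exact_mod_cast hj.le) hp0
    rw [← sub_eq_add_neg] at this
    linarith
  rw [div_eq_mul_one_div]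
  exact mul_le_mul_of_nonneg_left h2 (by positivity)

/-- The probability that prescribed pairs of selected vertices are adjacent. -/
lemma binomialRandom_real_picked_adj_le {φ : ℕ → ℕ → V} {M v : ℕ} {d : ℕ → ℕ} (hM : 0 < M)
    (hφ : DistinctBlocks φ M v) {c : ℝ} (hc0 : 0 < c) (hc1 : c ≤ 1)
    (hc : ∀ j < v, ∀ y, (∀ i < j, y i ∈ φ i '' Set.Iio M) → ∀ b < M,
      c ≤ (binomialRandom V p).real {Γ | d j ≤ (Γ.nbrIn (φ j b) (initSet y j)).card})
    {F : Finset (ℕ × ℕ)} (hF : ∀ e ∈ F, e.1 < e.2 ∧ e.2 < v) :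
    (binomialRandom V p).real {Γ |
      (∀ j < v, Γ.HasCandidate (φ j) M (d j) (initSet (Γ.picked φ M d) j)) ∧
      ∀ e ∈ F, Γ.Adj (Γ.picked φ M d e.1) (Γ.picked φ M d e.2)} ≤ (p / c) ^ F.card := by
  classical
  have hp0 : (0 : ℝ) ≤ p := p.2.1
  have hcard : F.card = ∑ j ∈ Finset.range v, (F.filter fun e => e.2 = j).card :=
    Finset.card_eq_sum_card_fiberwise fun e he => by simpa using (hF e he).2
  have h := binomialRandom_real_forall_picked_le (p := p) (d := d) hM hφ
    (𝓕 := fun j y N => ∀ i, (i, j) ∈ F → y i ∈ N)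
    (ρ := fun j => (p / c) ^ (F.filter fun e => e.2 = j).card) ?_ ?_ ?_
  · rw [hcard, ← Finset.prod_pow_eq_pow_sum]
    refine le_trans (measureReal_mono ?_ (measure_ne_top _ _)) h
    rintro Γ ⟨h1, h2⟩ j hj
    refine ⟨h1 j hj, fun i hi => ?_⟩
    rw [mem_nbrIn, mem_initSet]
    exact ⟨⟨i, (hF _ hi).1, rfl⟩, (h2 _ hi).symm⟩
  · intro j _
    positivity
  · intro j hj y y' N hyy' h i hi
    rw [← hyy' i (hF _ hi).1]
    exact h i hi
  · intro j hj y hy b hb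
    have hg := hc j hj y hy b hb
    set m := (F.filter fun e => e.2 = j).card with hm
    -- The estimate below pays for conditioning by `c ^ m ≤ c`, which needs `m ≥ 1`.
    rcases Nat.eq_zero_or_pos m with h0 | hpos
    · rw [h0, pow_zero, one_mul]
      exact measureReal_mono (fun Γ h => h.1) (measure_ne_top _ _)
    let T : Finset V := (F.filter fun e => e.2 = j).image fun e => y e.1
    have hTsub : T ⊆ initSet y j := by
      intro u hu
      simp only [T, Finset.mem_image, Finset.mem_filter] at hu
      obtain ⟨e, ⟨he, rfl⟩, rfl⟩ := hu
      exact mem_initSet.2 ⟨e.1, (hF e he).1, rfl⟩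
    have hTcard : T.card = m := by
      refine Finset.card_image_of_injOn ?_
      intro e he e' he' hee'
      simp only [Finset.coe_filter, Set.mem_ofPred_eq] at he he'
      have := (hφ.mono hj.le).injOn hy (x₁ := e.1) (x₂ := e'.1)
        (by simpa [← he.2] using (hF e he.1).1) (by simpa [← he'.2] using (hF e' he'.1).1) hee'
      exact Prod.ext this (he.2.trans he'.2.symm)
    have hw : φ j b ∉ T := fun hmem =>
      hφ.notMem_blocks hj hb (initSet_subset_blocks hy (hTsub hmem))
    calc _ ≤ (binomialRandom V p).real {Γ | ∀ u ∈ T, Γ.Adj (φ j b) u} := by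
          refine measureReal_mono ?_ (measure_ne_top _ _)
          rintro Γ ⟨-, h⟩ u hu
          simp only [T, Finset.mem_image, Finset.mem_filter] at hu
          obtain ⟨e, ⟨he, rfl⟩, rfl⟩ := hu
          exact (mem_nbrIn.1 (h e.1 he)).2
      _ = (p : ℝ) ^ m := by rw [binomialRandom_real_forall_adj hw, hTcard]
      _ = (p / c) ^ m * c ^ m := by rw [div_pow]; field_simp
      _ ≤ (p / c) ^ m * c :=
          mul_le_mul_of_nonneg_left (pow_le_of_le_one hc0.le hc1 hpos.ne') (by positivity)
      _ ≤ _ := mul_le_mul_of_nonneg_left hg (by positivity)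

/-- The probability that there is no edge between two given sets of `s` selected vertices. -/
lemma binomialRandom_real_picked_not_adj_le {φ : ℕ → ℕ → V} {M v s D : ℕ} {d : ℕ → ℕ} (hM : 0 < M)
    (hφ : DistinctBlocks φ M v) (hpv : v * (p : ℝ) ≤ 1 / 2) (hs : 0 < s)
    (hd : ∀ j, s ≤ j → d j = D) {L U : Finset ℕ} (hL : L.card = s) (hU : U.card = s)
    (hUv : ∀ u ∈ U, u < v) (hLU : ∀ l ∈ L, ∀ u ∈ U, l < u) :
    (binomialRandom V p).real {Γ |
      (∀ j < v, Γ.HasCandidate (φ j) M (d j) (initSet (Γ.picked φ M d) j)) ∧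
      ∀ l ∈ L, ∀ u ∈ U, ¬ Γ.Adj (Γ.picked φ M d l) (Γ.picked φ M d u)} ≤
      (2 * (1 - s / v : ℝ) ^ D) ^ s := by
  classical
  have hp0 : (0 : ℝ) ≤ p := p.2.1
  -- Each `u ∈ U` lies above the `s` elements of `L`, so the demand in its block is `D`.
  have hsu : ∀ u ∈ U, s ≤ u := by
    intro u hu
    rw [← hL, ← Finset.card_range u]
    exact Finset.card_le_card fun l hl => Finset.mem_range.2 (hLU l hl u hu)
  have hsv : (s : ℝ) / v ≤ 1 := by
    obtain ⟨u, hu⟩ : U.Nonempty := Finset.card_pos.1 (hU ▸ hs)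
    refine div_le_one_of_le₀ ?_ (by positivity)
    exact_mod_cast (hsu u hu).trans (hUv u hu).le
  have hρ0 : (0 : ℝ) ≤ 2 * (1 - s / v : ℝ) ^ D := by
    have : (0 : ℝ) ≤ 1 - s / v := by linarith
    positivity
  have h := binomialRandom_real_forall_picked_le (p := p) (d := d) hM hφ
    (𝓕 := fun j y N => j ∈ U → ∀ l ∈ L, y l ∉ N)
    (ρ := fun j => if j ∈ U then 2 * (1 - s / v : ℝ) ^ D else 1) ?_ ?_ ?_
  · rw [Finset.prod_ite, Finset.prod_const_one, mul_one, Finset.prod_const,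
      Finset.filter_mem_eq_inter, Finset.inter_eq_right.2 fun u hu => Finset.mem_range.2 (hUv u hu),
      hU] at h
    refine le_trans (measureReal_mono ?_ (measure_ne_top _ _)) h
    rintro Γ ⟨h1, h2⟩ j hj
    exact ⟨h1 j hj, fun hjU l hl hm => h2 l hl j hjU (mem_nbrIn.1 hm).2.symm⟩
  · intro j _
    split_ifs
    exacts [hρ0, zero_le_one]
  · intro j hj y y' N hyy' h hjU l hl
    rw [← hyy' l (hLU l hl j hjU)]
    exact h hjU l hl
  · intro j hj y hy b hb
    split_ifs with hjU
    swap
    · rw [one_mul]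
      exact measureReal_mono (fun Γ h => h.1) (measure_ne_top _ _)
    have hg := le_binomialRandom_real_initSet (p := p) hφ hpv hj hy hb D
    rw [hd j (hsu j hjU)]
    have hLj : ∀ l ∈ L, l < j := fun l hl => hLU l hl j hjU
    have hLsub : L.image y ⊆ initSet y j := by
      intro u hu
      obtain ⟨l, hl, rfl⟩ := Finset.mem_image.1 hu
      exact mem_initSet.2 ⟨l, hLj l hl, rfl⟩
    have hLcard : (L.image y).card = s := by
      rw [Finset.card_image_of_injOn, hL]
      exact ((hφ.mono hj.le).injOn hy).mono fun l hl => hLj l hl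
    have hRcard : (initSet y j \ L.image y).card = j - s := by
      rw [Finset.card_sdiff_of_subset hLsub, hLcard, card_initSet hφ hj hy]
    have hw : φ j b ∉ initSet y j \ L.image y := fun hmem =>
      hφ.notMem_blocks hj hb (initSet_subset_blocks hy (Finset.sdiff_subset hmem))
    have hj0 : (0 : ℝ) < j := by exact_mod_cast hs.trans_le (hsu j hjU)
    have hv0 : (0 : ℝ) < v := hj0.trans (by exact_mod_cast hj)
    have hsj : (s : ℝ) ≤ j := by exact_mod_cast hsu j hjU
    have hratio : ((j - s).choose D : ℝ) ≤ j.choose D * (1 - s / v : ℝ) ^ D := by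
      have h1 := choose_sub_mul_pow_le j s D (hsu j hjU)
      have h2 : ((j - s).choose D : ℝ) ≤ j.choose D * (1 - s / j : ℝ) ^ D := by
        have : (1 - s / j : ℝ) = (j - s) / j := by field_simp
        rw [this, div_pow, ← mul_div_assoc, le_div_iff₀ (by positivity)]
        exact h1
      refine h2.trans (mul_le_mul_of_nonneg_left ?_ (by positivity))
      refine pow_le_pow_left₀ ?_ ?_ D
      · rw [sub_nonneg]; exact div_le_one_of_le₀ hsj hj0.le
      · have : (s : ℝ) / v ≤ s / j :=
          div_le_div_of_nonneg_left (by positivity) hj0 (by exact_mod_cast hj.le)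
        linarith
    -- Avoiding `L` forces all `D` neighbours into the other `j - s` earlier picks; the ratio of
    -- binomial coefficients gives the gain `(1 - s / v) ^ D`.
    calc _ ≤ (binomialRandom V p).real
            {Γ | D ≤ (Γ.nbrIn (φ j b) (initSet y j \ L.image y)).card} := by
          refine measureReal_mono ?_ (measure_ne_top _ _)
          rintro Γ ⟨h1, h2⟩
          refine h1.trans (Finset.card_le_card fun u hu => ?_)
          rw [mem_nbrIn, Finset.mem_sdiff]
          refine ⟨⟨(mem_nbrIn.1 hu).1, fun hm => ?_⟩, (mem_nbrIn.1 hu).2⟩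
          obtain ⟨l, hl, rfl⟩ := Finset.mem_image.1 hm
          exact h2 hjU l hl hu
      _ ≤ (j - s).choose D * (p : ℝ) ^ D := by
          have := binomialRandom_real_le_card_nbrIn_le (p := p) hw D
          rwa [hRcard] at this
      _ ≤ j.choose D * (1 - s / v : ℝ) ^ D * (p : ℝ) ^ D :=
          mul_le_mul_of_nonneg_right hratio (by positivity)
      _ = 2 * (1 - s / v : ℝ) ^ D * (j.choose D * (p : ℝ) ^ D / 2) := by ring
      _ ≤ _ := mul_le_mul_of_nonneg_left hg hρ0

end Bounds

/-! ### From expansion and few short closed trails to the subgraph -/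

section Deterministic

/-- Cut at the least `m` with `s` elements of `A` below it, so that `s` elements of `A` also remain
above. At least `s` elements of `B` lie on one side of `m`; pair them with the elements of `A` on
the other side. -/
lemma exists_separated_subsets {A B : Finset ℕ} {s : ℕ} (hA : 2 * s ≤ A.card)
    (hB : 2 * s ≤ B.card) : ∃ L U : Finset ℕ, L.card = s ∧ U.card = s ∧
      (∀ l ∈ L, ∀ u ∈ U, l < u) ∧ (L ⊆ A ∧ U ⊆ B ∨ L ⊆ B ∧ U ⊆ A) := by
  have hex : ∃ m, s ≤ (A.filter (· < m)).card := by
    refine ⟨A.sup id + 1, ?_⟩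
    have h : ∀ a ∈ A, a < A.sup id + 1 := fun a ha => Nat.lt_succ_of_le (Finset.le_sup (f := id) ha)
    rw [Finset.filter_true_of_mem h]
    omega
  obtain ⟨m, hm, hmin⟩ : ∃ m, s ≤ (A.filter (· < m)).card ∧
      ∀ m' < m, ¬ s ≤ (A.filter (· < m')).card :=
    ⟨Nat.find hex, Nat.find_spec hex, fun m' hm' => Nat.find_min hex hm'⟩
  have hle : (A.filter (· < m)).card ≤ s := by
    rcases m with _ | m
    · simp
    · have h1 := hmin m m.lt_succ_self
      have h2 : A.filter (· < m + 1) ⊆ insert m (A.filter (· < m)) := by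
        intro a ha
        simp only [Finset.mem_filter, Finset.mem_insert] at ha ⊢
        rcases Nat.lt_succ_iff_lt_or_eq.1 ha.2 with h | h
        exacts [Or.inr ⟨ha.1, h⟩, Or.inl h]
      have h3 := (Finset.card_le_card h2).trans (Finset.card_insert_le _ _)
      omega
  have hA' := Finset.card_filter_add_card_filter_not (s := A) (· < m)
  have hB' := Finset.card_filter_add_card_filter_not (s := B) (· < m)
  rcases le_or_gt s (B.filter (¬ · < m)).card with h | h
  · obtain ⟨L, hL, hLc⟩ := Finset.exists_subset_card_eq hm
    obtain ⟨U, hU, hUc⟩ := Finset.exists_subset_card_eq h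
    refine ⟨L, U, hLc, hUc, fun l hl u hu => ?_, Or.inl ⟨hL.trans (Finset.filter_subset _ _),
      hU.trans (Finset.filter_subset _ _)⟩⟩
    have h1 := (Finset.mem_filter.1 (hL hl)).2
    have h2 := (Finset.mem_filter.1 (hU hu)).2
    omega
  · obtain ⟨L, hL, hLc⟩ := Finset.exists_subset_card_eq (s := B.filter (· < m)) (n := s) (by omega)
    obtain ⟨U, hU, hUc⟩ := Finset.exists_subset_card_eq (s := A.filter (¬ · < m)) (n := s) (by omega)
    refine ⟨L, U, hLc, hUc, fun l hl u hu => ?_, Or.inr ⟨hL.trans (Finset.filter_subset _ _),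
      hU.trans (Finset.filter_subset _ _)⟩⟩
    have h1 := (Finset.mem_filter.1 (hL hl)).2
    have h2 := (Finset.mem_filter.1 (hU hu)).2
    omega

variable {V : Type*} {Γ : SimpleGraph V}

/-- If any two disjoint linear sized subsets of `S` span an edge, then `Γ[S]` has large chromatic
number. -/
lemma le_chromaticNumber_induce_of_forall_exists_adj {S : Finset V} {k : ℕ} {ε : ℝ} (hε : 0 ≤ ε)
    (hkε : 4 * k * ε ≤ 1) (hS : 4 * k ≤ S.card)
    (h : ∀ A B : Finset V, A ⊆ S → B ⊆ S → Disjoint A B → ε * S.card ≤ A.card →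
      ε * S.card ≤ B.card → ∃ a ∈ A, ∃ b ∈ B, Γ.Adj a b) :
    (k : ℕ∞) ≤ ((⊤ : Γ.Subgraph).induce S).coe.chromaticNumber := by
  classical
  rw [le_chromaticNumber_iff_colorable]
  rintro m ⟨C⟩
  by_contra! hmk
  have hmk : m < k := by exact_mod_cast hmk
  have hk : (0 : ℝ) < k := by exact_mod_cast (Nat.zero_le m).trans_lt hmk
  let g : {u // u ∈ S} → Fin m := fun u => C ⟨u.1, u.2⟩
  have hSpos : 0 < S.card := by omega
  obtain ⟨u₀, hu₀⟩ := Finset.card_pos.1 hSpos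
  have : Nonempty (Fin m) := ⟨g ⟨u₀, hu₀⟩⟩
  obtain ⟨i, -, hi⟩ := Finset.exists_le_card_fiber_of_nsmul_le_card_of_maps_to
    (s := S.attach) (t := (Finset.univ : Finset (Fin m))) (f := g) (b := (S.card : ℝ) / k)
    (fun _ _ => Finset.mem_univ _) Finset.univ_nonempty (by
      rw [Finset.card_univ, Fintype.card_fin, Finset.card_attach, nsmul_eq_mul,
        ← mul_div_assoc, div_le_iff₀ hk, mul_comm]
      exact mul_le_mul_of_nonneg_left (by exact_mod_cast hmk.le) (by positivity))
  set K := S.attach.filter fun u => g u = i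
  set q := ⌈ε * S.card⌉₊ with hq
  -- The colour class has at least `S.card / k` elements. Half of this covers `2 ε S.card` by `hkε`,
  -- the other half covers the rounding loss `2` by `hS`.
  have h2q : 2 * q ≤ K.card := by
    have h1 : (q : ℝ) < ε * S.card + 1 := Nat.ceil_lt_add_one (by positivity)
    have h2 : (4 : ℝ) * k ≤ S.card := by exact_mod_cast hS
    have h3 : 2 * (ε * S.card) + 2 ≤ S.card / k := by
      rw [le_div_iff₀ hk]
      nlinarith [mul_le_mul_of_nonneg_right hkε (Nat.cast_nonneg (α := ℝ) S.card)]
    have : (2 * q : ℝ) ≤ K.card := by linarith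
    exact_mod_cast this
  obtain ⟨A, hA, hAq⟩ := Finset.exists_subset_card_eq (s := K) (n := q) (by omega)
  obtain ⟨B, hB, hBq⟩ := Finset.exists_subset_card_eq (s := K \ A) (n := q) (by
    rw [Finset.card_sdiff_of_subset hA]; omega)
  have hsub : ∀ A : Finset {u // u ∈ S}, A.map (Function.Embedding.subtype _) ⊆ S := by
    intro A u hu
    obtain ⟨u, -, rfl⟩ := Finset.mem_map.1 hu
    exact u.2
  obtain ⟨a, ha, b, hb, hab⟩ := h (A.map (Function.Embedding.subtype _))
    (B.map (Function.Embedding.subtype _)) (hsub A) (hsub B)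
    ((Finset.disjoint_map _).2 (Finset.disjoint_of_subset_right hB Finset.disjoint_sdiff))
    (by rw [Finset.card_map, hAq]; exact Nat.le_ceil _)
    (by rw [Finset.card_map, hBq]; exact Nat.le_ceil _)
  obtain ⟨a, haA, rfl⟩ := Finset.mem_map.1 ha
  obtain ⟨b, hbB, rfl⟩ := Finset.mem_map.1 hb
  have h1 : g a = i := (Finset.mem_filter.1 (hA haA)).2
  have h2 : g b = i := (Finset.mem_filter.1 (Finset.sdiff_subset (hB hbB))).2
  refine C.valid (v := ⟨a.1, a.2⟩) (w := ⟨b.1, b.2⟩) ?_ (h1.trans h2.symm)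
  simpa using hab

/-- The vertices `x (f 0), …, x (f ℓ)` form a closed walk without repeated edges. -/
def IsClosedTrail (Γ : SimpleGraph V) (x : ℕ → V) {v ℓ : ℕ} (f : Fin (ℓ + 1) → Fin v) : Prop :=
  (Function.Injective fun i => s(f i, f (i + 1))) ∧
    ∀ i, Γ.Adj (x (f i)) (x (f (i + 1)))

lemma Walk.IsCycle.exists_isClosedTrail {x : ℕ → V} {v k : ℕ} {a : V} {w : Γ.Walk a a}
    (hw : w.IsCycle) (hk : w.length < k) (hx : ∀ u ∈ w.support, ∃ i < v, x i = u) :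
    ∃ g : (ℓ : Fin k) × (Fin (ℓ + 1) → Fin v), Γ.IsClosedTrail x g.2 ∧ x (g.2 0) = a := by
  obtain ⟨ℓ, hℓ⟩ : ∃ ℓ, w.length = ℓ + 1 := ⟨w.length - 1, by have := hw.three_le_length; omega⟩
  have hx' : ∀ i : ℕ, ∃ j : Fin v, x j = w.getVert i := fun i => by
    obtain ⟨j, hj, h⟩ := hx _ (w.getVert_mem_support i)
    exact ⟨⟨j, hj⟩, h⟩
  choose g hg using hx'
  have hsucc : ∀ i : Fin (ℓ + 1), x (g ((i + 1 : Fin (ℓ + 1)) : ℕ)) = w.getVert (i + 1) := by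
    intro i
    rw [hg]
    -- Addition in `Fin (ℓ + 1)` wraps around at the last index, where the walk is back at `a`.
    rcases eq_or_ne i (Fin.last ℓ) with rfl | hi
    · simp [← hℓ]
    · rw [Fin.val_add_one_of_lt (Fin.lt_last_iff_ne_last.2 hi)]
  refine ⟨⟨⟨ℓ, by omega⟩, fun i => g i⟩, ⟨?_, ?_⟩, ?_⟩
  · intro i j hij
    have h1 := congrArg (Sym2.map fun n : Fin v => x n) hij
    simp only [Sym2.map_mk, hg i.1, hg j.1, hsucc] at h1
    have hn := hw.edges_nodup
    have hi : (i : ℕ) < w.edges.length := by rw [Walk.length_edges, hℓ]; exact i.2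
    have hj : (j : ℕ) < w.edges.length := by rw [Walk.length_edges, hℓ]; exact j.2
    refine Fin.ext ((hn.getElem_inj_iff (hi := hi) (hj := hj)).1 ?_)
    simpa only [Walk.getElem_edges] using h1
  · intro i
    dsimp only
    rw [hsucc, hg]
    exact w.adj_getVert_succ (by rw [hℓ]; exact i.2)
  · simpa using hg 0

open Classical in
/-- If separated sets of `s` indices span edges and there are few short closed trails, then
deleting a vertex of each of them leaves the desired subgraph. -/
lemma exists_subgraph_of_picked [Finite V] {x : ℕ → V} {v s k : ℕ} {ε : ℝ} (hε : 0 ≤ ε)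
    (hkε : 4 * k * ε ≤ 1) (hv : 8 * k ≤ v) (hx : Set.InjOn x (Set.Iio v))
    (hs : 4 * (s : ℝ) ≤ ε * v)
    (hLU : ∀ L U : Finset ℕ, L.card = s → U.card = s → (∀ l ∈ L, l < v) → (∀ u ∈ U, u < v) →
      (∀ l ∈ L, ∀ u ∈ U, l < u) → ∃ l ∈ L, ∃ u ∈ U, Γ.Adj (x l) (x u))
    (hcyc : 2 * (Finset.univ.filter fun g : (ℓ : Fin k) × (Fin (ℓ + 1) → Fin v) =>
      Γ.IsClosedTrail x g.2).card ≤ v) :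
    ∃ G : Γ.Subgraph, G.verts.ncard ≤ v ∧ (k : ℕ∞) ≤ G.coe.chromaticNumber ∧
      (k : ℕ∞) ≤ G.coe.egirth ∧ ∀ A B : Set V, A ⊆ G.verts → B ⊆ G.verts → Disjoint A B →
        ε * G.verts.ncard ≤ A.ncard → ε * G.verts.ncard ≤ B.ncard →
        ∃ a ∈ A, ∃ b ∈ B, G.Adj a b := by
  set bad := Finset.univ.filter fun g : (ℓ : Fin k) × (Fin (ℓ + 1) → Fin v) =>
    Γ.IsClosedTrail x g.2
  let R : Finset V := (Finset.range v).image x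
  let Z : Finset V := bad.image fun g => x (g.2 0)
  have hR : R.card = v := by
    rw [Finset.card_image_of_injOn (by simpa using hx), Finset.card_range]
  have hZ : Z.card ≤ bad.card := Finset.card_image_le
  let S := R \ Z
  have hSv : v ≤ 2 * S.card := by
    have := Finset.le_card_sdiff Z R
    simp only [S]
    omega
  have hSle : S.card ≤ v := (Finset.card_le_card Finset.sdiff_subset).trans hR.le
  have hAB : ∀ A B : Finset V, A ⊆ S → B ⊆ S → ε * S.card ≤ A.card →
      ε * S.card ≤ B.card → ∃ a ∈ A, ∃ b ∈ B, Γ.Adj a b := by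
    intro A B hA hB hAc hBc
    -- Half of the vertices survive, so `4 s ≤ ε v ≤ 2 ε S.card`.
    have hpre : ∀ A : Finset V, A ⊆ S → ε * S.card ≤ A.card →
        2 * s ≤ ((Finset.range v).filter fun i => x i ∈ A).card := by
      intro A hA hAc
      have h1 : A ⊆ ((Finset.range v).filter fun i => x i ∈ A).image x := by
        intro a ha
        obtain ⟨i, hi, rfl⟩ := Finset.mem_image.1 (Finset.sdiff_subset (hA ha))
        exact Finset.mem_image.2 ⟨i, Finset.mem_filter.2 ⟨hi, ha⟩, rfl⟩
      refine le_trans ?_ ((Finset.card_le_card h1).trans Finset.card_image_le)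
      have h2 : (v : ℝ) ≤ 2 * S.card := by exact_mod_cast hSv
      have h3 : (2 * s : ℝ) ≤ A.card := by nlinarith
      exact_mod_cast h3
    obtain ⟨L, U, hL, hU, hlt, hsub⟩ := exists_separated_subsets (hpre A hA hAc) (hpre B hB hBc)
    have hmem : ∀ {A : Finset V} {L : Finset ℕ},
        L ⊆ ((Finset.range v).filter fun i => x i ∈ A) → ∀ l ∈ L, l < v ∧ x l ∈ A := by
      intro A L h l hl
      simpa using h hl
    rcases hsub with ⟨h1, h2⟩ | ⟨h1, h2⟩
    · obtain ⟨l, hl, u, hu, h⟩ := hLU L U hL hU (fun l hl => (hmem h1 l hl).1)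
        (fun u hu => (hmem h2 u hu).1) hlt
      exact ⟨x l, (hmem h1 l hl).2, x u, (hmem h2 u hu).2, h⟩
    · obtain ⟨l, hl, u, hu, h⟩ := hLU L U hL hU (fun l hl => (hmem h1 l hl).1)
        (fun u hu => (hmem h2 u hu).1) hlt
      exact ⟨x u, (hmem h2 u hu).2, x l, (hmem h1 l hl).2, h.symm⟩
  have hverts : ((⊤ : Γ.Subgraph).induce (S : Set V)).verts = S := rfl
  refine ⟨(⊤ : Γ.Subgraph).induce S, ?_, ?_, ?_, ?_⟩
  · rw [hverts, Set.ncard_coe_finset]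
    exact hSle
  · exact le_chromaticNumber_induce_of_forall_exists_adj hε hkε (by omega)
      fun A B hA hB _ => hAB A B hA hB
  · rw [le_egirth]
    intro a w hw
    by_contra! hlt
    have hlt : w.length < k := by exact_mod_cast hlt
    set G := (⊤ : Γ.Subgraph).induce (S : Set V)
    have hw' : (w.map G.hom).IsCycle := hw.map G.hom_injective
    have hsupp : ∀ u ∈ (w.map G.hom).support, u ∈ S := by
      intro u hu
      rw [Walk.support_map] at hu
      obtain ⟨u', -, rfl⟩ := List.mem_map.1 hu
      exact u'.2
    obtain ⟨g, hg, hga⟩ := hw'.exists_isClosedTrail (x := x) (v := v) (k := k)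
      (by rwa [Walk.length_map]) (fun u hu => by
        simpa [R] using Finset.sdiff_subset (hsupp u hu))
    -- The base point of a short cycle starts a counted closed trail, so it was deleted.
    refine (Finset.mem_sdiff.1 (show G.hom _ ∈ S from Subtype.property _)).2 (Finset.mem_image.2 ⟨g, ?_, hga⟩)
    simpa [bad] using hg
  · intro A B hA hB _ hAc hBc
    rw [hverts] at hA hB hAc hBc
    rw [Set.ncard_coe_finset] at hAc hBc
    obtain ⟨a, ha, b, hb, hab⟩ := hAB A.toFinite.toFinset B.toFinite.toFinset
      (by simpa using hA) (by simpa using hB)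
      (by rwa [← Set.ncard_eq_toFinset_card]) (by rwa [← Set.ncard_eq_toFinset_card])
    rw [Set.Finite.mem_toFinset] at ha hb
    exact ⟨a, ha, b, hb, by simpa using ⟨hA ha, hB hb, hab⟩⟩

end Deterministic

/-! ### The failure probability for fixed parameters -/

section Assembly

variable {V : Type*} [Finite V] {p : I}

open Classical in
/-- Markov's inequality for the number of events that occur. -/
lemma mul_measureReal_le_card_filter_le {ι : Type*} [Fintype ι] (μ : Measure (SimpleGraph V))
    [IsProbabilityMeasure μ] (E : ι → Set (SimpleGraph V)) (t : ℝ) :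
    t * μ.real {Γ | t ≤ ((Finset.univ.filter fun i => Γ ∈ E i).card : ℝ)} ≤
      ∑ i, μ.real (E i) := by
  have hcard : ∀ Γ : SimpleGraph V, ((Finset.univ.filter fun i => Γ ∈ E i).card : ℝ) =
      ∑ i, (E i).indicator 1 Γ := by
    intro Γ
    simp [Set.indicator_apply]
  simp only [hcard]
  refine (mul_meas_ge_le_integral_of_nonneg ?_ ?_ t).trans (le_of_eq ?_)
  · exact Filter.Eventually.of_forall fun Γ => Finset.sum_nonneg fun i _ =>
      Set.indicator_nonneg (fun _ _ => zero_le_one) _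
  · exact Integrable.of_finite
  · rw [integral_finsetSum _ fun i _ => Integrable.of_finite]
    exact Finset.sum_congr rfl fun i _ => integral_indicator_one .of_discrete

lemma binomialRandom_real_isClosedTrail_le {φ : ℕ → ℕ → V} {M v : ℕ} {d : ℕ → ℕ} (hM : 0 < M)
    (hφ : DistinctBlocks φ M v) {c : ℝ} (hc0 : 0 < c) (hc1 : c ≤ 1)
    (hc : ∀ j < v, ∀ y, (∀ i < j, y i ∈ φ i '' Set.Iio M) → ∀ b < M,
      c ≤ (binomialRandom V p).real {Γ | d j ≤ (Γ.nbrIn (φ j b) (initSet y j)).card})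
    {ℓ : ℕ} (f : Fin (ℓ + 1) → Fin v) :
    (binomialRandom V p).real {Γ |
      (∀ j < v, Γ.HasCandidate (φ j) M (d j) (initSet (Γ.picked φ M d) j)) ∧
      Γ.IsClosedTrail (Γ.picked φ M d) f} ≤ (p / c) ^ (ℓ + 1) := by
  classical
  have hp0 : (0 : ℝ) ≤ p := p.2.1
  -- Otherwise the event is empty. In the remaining case the `ℓ + 1` steps are distinct pairs,
  -- ordered by `min` and `max` to match the order of selection.
  by_cases hf : (Function.Injective fun i => s(f i, f (i + 1))) ∧ ∀ i, f i ≠ f (i + 1)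
  swap
  · have : {Γ : SimpleGraph V |
        (∀ j < v, Γ.HasCandidate (φ j) M (d j) (initSet (Γ.picked φ M d) j)) ∧
        Γ.IsClosedTrail (Γ.picked φ M d) f} = ∅ := by
      refine Set.eq_empty_of_forall_notMem ?_
      rintro Γ ⟨-, h1, h2⟩
      exact hf ⟨h1, fun i hi => (h2 i).ne (by rw [← hi])⟩
    rw [this, measureReal_empty]
    positivity
  let e : Fin (ℓ + 1) → ℕ × ℕ := fun i =>
    (min (f i : ℕ) (f (i + 1)), max (f i : ℕ) (f (i + 1)))
  have he : Function.Injective e := by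
    intro i j hij
    refine hf.1 ?_
    simp only [e, Prod.mk.injEq] at hij
    rw [Sym2.eq_iff, Fin.ext_iff, Fin.ext_iff, Fin.ext_iff, Fin.ext_iff]
    omega
  have h := binomialRandom_real_picked_adj_le (p := p) (d := d) hM hφ hc0 hc1 hc
    (F := Finset.univ.image e) ?_
  · rw [Finset.card_image_of_injective _ he, Finset.card_univ, Fintype.card_fin] at h
    refine le_trans (measureReal_mono ?_ (measure_ne_top _ _)) h
    rintro Γ ⟨h1, -, h2⟩
    refine ⟨h1, fun e' he' => ?_⟩
    obtain ⟨i, -, rfl⟩ := Finset.mem_image.1 he'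
    rcases le_total (f i : ℕ) (f (i + 1)) with hle | hle
    · simpa only [e, min_eq_left hle, max_eq_right hle] using h2 i
    · simpa only [e, min_eq_right hle, max_eq_left hle] using (h2 i).symm
  · intro e' he'
    obtain ⟨i, -, rfl⟩ := Finset.mem_image.1 he'
    have h1 := hf.2 i
    rw [Ne, Fin.ext_iff] at h1
    have h2 := (f i).2
    have h3 := (f (i + 1)).2
    simp only [e]
    omega

/-- The graph has a subgraph on at most `v` vertices with chromatic number and girth at least `k`
and edges between any two disjoint sets containing an `ε` proportion of its vertices. -/
def HasGoodSubgraph (Γ : SimpleGraph V) (v k : ℕ) (ε : ℝ) : Prop :=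
  ∃ G : Γ.Subgraph, G.verts.ncard ≤ v ∧ (k : ℕ∞) ≤ G.coe.chromaticNumber ∧
    (k : ℕ∞) ≤ G.coe.egirth ∧ ∀ A B : Set V, A ⊆ G.verts → B ⊆ G.verts → Disjoint A B →
      ε * G.verts.ncard ≤ A.ncard → ε * G.verts.ncard ≤ B.ncard →
      ∃ a ∈ A, ∃ b ∈ B, G.Adj a b

-- The three terms bound the failure of some block, a pair of separated `s`-sets with no edge
-- between them, and at least `v / 2` short closed trails.
open Classical in
lemma binomialRandom_real_not_hasGoodSubgraph_le {φ : ℕ → ℕ → V} {v s k D : ℕ} {ε c : ℝ}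
    (hφ : DistinctBlocks φ v v) (hε : 0 ≤ ε) (hk : 0 < k) (hkε : 4 * k * ε ≤ 1) (hv : 8 * k ≤ v)
    (hv0 : 0 < v) (hs0 : 0 < s) (hs : 4 * (s : ℝ) ≤ ε * v) (hpv : v * (p : ℝ) ≤ 1 / 2)
    (hc0 : 0 < c) (hc2 : c ≤ 1 / 2)
    (hc : ∀ j, s ≤ j → j < v → c ≤ j.choose D * (p : ℝ) ^ D / 2) :
    (binomialRandom V p).real {Γ | ¬ Γ.HasGoodSubgraph v k ε} ≤
      v * (1 - c) ^ v + 4 ^ v * (2 * (1 - s / v : ℝ) ^ D) ^ s +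
        2 * (∑ ℓ : Fin k, (1 / c) ^ ((ℓ : ℕ) + 1)) / v := by
  set μ := binomialRandom V p
  have hp0 : (0 : ℝ) ≤ p := p.2.1
  have hvR : (0 : ℝ) < v := by exact_mod_cast hv0
  -- Early blocks have too few predecessors for the bound `c`. With demand `0` the available bound
  -- is `1 / 2`, hence the hypothesis `hc2`.
  let d : ℕ → ℕ := fun j => if j < s then 0 else D
  have hd : ∀ j, s ≤ j → d j = D := fun j hj => if_neg (by omega)
  have hcand : ∀ j < v, ∀ y, (∀ i < j, y i ∈ φ i '' Set.Iio v) → ∀ b < v,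
      c ≤ μ.real {Γ | d j ≤ (Γ.nbrIn (φ j b) (initSet y j)).card} := by
    intro j hj y hy b hb
    refine le_trans ?_ (le_binomialRandom_real_initSet hφ hpv hj hy hb (d j))
    rcases lt_or_ge j s with h | h
    · simpa [d, h] using hc2
    · rw [hd j h]
      exact hc j h hj
  let x : SimpleGraph V → ℕ → V := fun Γ => Γ.picked φ v d
  let cand : SimpleGraph V → Prop := fun Γ =>
    ∀ j < v, Γ.HasCandidate (φ j) v (d j) (initSet (x Γ) j)
  let P : Finset (Finset ℕ × Finset ℕ) := ((Finset.range v).powerset ×ˢ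
    (Finset.range v).powerset).filter fun q =>
      q.1.card = s ∧ q.2.card = s ∧ ∀ l ∈ q.1, ∀ u ∈ q.2, l < u
  let N : Finset ℕ × Finset ℕ → Set (SimpleGraph V) := fun q =>
    {Γ | cand Γ ∧ ∀ l ∈ q.1, ∀ u ∈ q.2, ¬ Γ.Adj (x Γ l) (x Γ u)}
  let E : (ℓ : Fin k) × (Fin (ℓ + 1) → Fin v) → Set (SimpleGraph V) := fun g =>
    {Γ | cand Γ ∧ Γ.IsClosedTrail (x Γ) g.2}
  let B : Set (SimpleGraph V) :=
    {Γ | (v / 2 : ℝ) ≤ ((Finset.univ.filter fun g => Γ ∈ E g).card : ℝ)}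
  have hsub : {Γ | ¬ Γ.HasGoodSubgraph v k ε} ⊆
      ({Γ | ∃ j < v, ¬ Γ.HasCandidate (φ j) v (d j) (initSet (x Γ) j)} ∪ ⋃ q ∈ P, N q) ∪ B := by
    intro Γ hΓ
    by_contra hcon
    simp only [Set.mem_union, not_or] at hcon
    obtain ⟨⟨h1, h2⟩, h3⟩ := hcon
    have h1 : cand Γ := by
      intro j hj
      by_contra h
      exact h1 ⟨j, hj, h⟩
    refine hΓ (exists_subgraph_of_picked (x := x Γ) (s := s) hε hkε hv
      (hφ.injOn fun i _ => picked_mem hv0 i) hs ?_ ?_)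
    · intro L U hL hU hLv hUv hLU
      by_contra! h
      refine h2 ?_
      simp only [Set.mem_iUnion]
      refine ⟨(L, U), ?_, h1, h⟩
      simp only [P, Finset.mem_filter, Finset.mem_product, Finset.mem_powerset]
      exact ⟨⟨fun l hl => Finset.mem_range.2 (hLv l hl),
        fun u hu => Finset.mem_range.2 (hUv u hu)⟩, hL, hU, hLU⟩
    · have h4 : ((Finset.univ.filter fun g => Γ ∈ E g).card : ℝ) < v / 2 := not_le.1 h3
      have h5 : (Finset.univ.filter fun g => Γ ∈ E g) = Finset.univ.filter fun g :
          (ℓ : Fin k) × (Fin (ℓ + 1) → Fin v) => Γ.IsClosedTrail (x Γ) g.2 := by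
        refine Finset.filter_congr fun g _ => ?_
        exact ⟨fun h => h.2, fun h => ⟨h1, h⟩⟩
      rw [h5] at h4
      have h6 : (2 * (Finset.univ.filter fun g : (ℓ : Fin k) × (Fin (ℓ + 1) → Fin v) =>
          Γ.IsClosedTrail (x Γ) g.2).card : ℝ) ≤ v := by linarith
      exact_mod_cast h6
  have hsv : (s : ℝ) / v ≤ 1 := by
    rw [div_le_one hvR]
    have : (1 : ℝ) ≤ k := by exact_mod_cast hk
    nlinarith
  have hB1 := binomialRandom_real_exists_not_hasCandidate_le (p := p) hv0 hφ (by linarith) hcand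
  have hB2 : μ.real (⋃ q ∈ P, N q) ≤ 4 ^ v * (2 * (1 - s / v : ℝ) ^ D) ^ s := by
    have h0 : (0 : ℝ) ≤ 1 - s / v := by linarith
    calc _ ≤ ∑ q ∈ P, μ.real (N q) := measureReal_biUnion_finset_le _ _
      _ ≤ ∑ q ∈ P, (2 * (1 - s / v : ℝ) ^ D) ^ s := by
        refine Finset.sum_le_sum fun q hq => ?_
        simp only [P, Finset.mem_filter, Finset.mem_product, Finset.mem_powerset] at hq
        exact binomialRandom_real_picked_not_adj_le hv0 hφ hpv hs0 hd hq.2.1 hq.2.2.1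
          (fun u hu => Finset.mem_range.1 (hq.1.2 hu)) hq.2.2.2
      _ = P.card * (2 * (1 - s / v : ℝ) ^ D) ^ s := by simp
      _ ≤ _ := by
        refine mul_le_mul_of_nonneg_right ?_ (by positivity)
        have h1 : P.card ≤ 2 ^ v * 2 ^ v := by
          refine (Finset.card_filter_le _ _).trans ?_
          simp
        calc (P.card : ℝ) ≤ ((2 ^ v * 2 ^ v : ℕ) : ℝ) := by exact_mod_cast h1
          _ = 4 ^ v := by push_cast; rw [← mul_pow]; norm_num
  have hB3 : μ.real B ≤ 2 * (∑ ℓ : Fin k, (1 / c) ^ ((ℓ : ℕ) + 1)) / v := by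
    have h1 := mul_measureReal_le_card_filter_le μ E (v / 2)
    have h2 : ∑ g, μ.real (E g) ≤ ∑ ℓ : Fin k, (1 / c) ^ ((ℓ : ℕ) + 1) := by
      rw [Fintype.sum_sigma]
      refine Finset.sum_le_sum fun ℓ _ => ?_
      calc _ ≤ ∑ f : Fin ((ℓ : ℕ) + 1) → Fin v, (p / c : ℝ) ^ ((ℓ : ℕ) + 1) :=
            Finset.sum_le_sum fun f _ =>
              binomialRandom_real_isClosedTrail_le hv0 hφ hc0 (by linarith) hcand f
        _ = (v * p / c : ℝ) ^ ((ℓ : ℕ) + 1) := by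
            simp only [Finset.sum_const, Finset.card_univ, Fintype.card_fun, Fintype.card_fin,
              nsmul_eq_mul, Nat.cast_pow]
            rw [← mul_pow, mul_div_assoc]
        _ ≤ _ := by
            refine pow_le_pow_left₀ (by positivity) ?_ _
            exact div_le_div_of_nonneg_right (by linarith) hc0.le
    rw [le_div_iff₀ hvR]
    have h3 : v / 2 * μ.real B ≤ ∑ g, μ.real (E g) := by convert h1
    linarith
  calc _ ≤ _ := measureReal_mono hsub (measure_ne_top _ _)
    _ ≤ _ := measureReal_union_le _ _
    _ ≤ _ := add_le_add ((measureReal_union_le _ _).trans (add_le_add hB1 hB2)) hB3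

end Assembly

/-! ### Choice of constants and passage to the limit -/

section Limit

lemma distinctBlocks_fin {n v : ℕ} [NeZero n] (hvn : v * v ≤ n) :
    DistinctBlocks (fun i b => Fin.ofNat n (i * v + b)) v v := by
  have hlt : ∀ i < v, ∀ b < v, i * v + b < n := by
    intro i hi b hb
    have : (i + 1) * v ≤ v * v := Nat.mul_le_mul_right v hi
    rw [Nat.add_mul, one_mul] at this
    omega
  intro i hi b hb i' hi' b' hb' h
  have h1 : i * v + b = i' * v + b' := by
    have := congrArg Fin.val h
    simpa [Fin.ofNat, Nat.mod_eq_of_lt (hlt i hi b hb), Nat.mod_eq_of_lt (hlt i' hi' b' hb')]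
      using this
  have hv : 0 < v := by omega
  have h2 : i = i' := by
    have := congrArg (· / v) h1
    simpa [Nat.add_comm _ b, Nat.add_comm _ b', Nat.add_mul_div_right _ _ hv,
      Nat.div_eq_of_lt hb, Nat.div_eq_of_lt hb'] using this
  subst h2
  exact ⟨rfl, by omega⟩

/-- The failure probability is bounded by a null sequence in the number of selected vertices. -/
lemma exists_tendsto_zero_binomialRandom_real_le {k : ℕ} (hk : 0 < k) {ε : ℝ} (hε : 0 < ε)
    (hkε : 4 * k * ε ≤ 1) : ∃ err : ℕ → ℝ, Tendsto err atTop (𝓝 0) ∧ ∀ᶠ v : ℕ in atTop,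
      ∀ n : ℕ, ∀ p : I, v * v ≤ n → v * (p : ℝ) ≤ ε → ε / 2 ≤ v * (p : ℝ) →
        (binomialRandom (Fin n) p).real {Γ | ¬ Γ.HasGoodSubgraph v k ε} ≤ err v := by
  have hε4 : ε ≤ 1 / 4 := by
    have : (1 : ℝ) ≤ k := by exact_mod_cast hk
    nlinarith
  -- As `s ≥ ε v / 8`, this gives `v ≤ N * s`. The choice of `D` then bounds the expansion term by
  -- `4 ^ v * (1 / 8) ^ v`.
  set N := ⌈8 / ε⌉₊ with hN
  obtain ⟨D, hD⟩ : ∃ D : ℕ, (1 - ε / 8) ^ D < (1 / 8) ^ N / 2 :=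
    exists_pow_lt_of_lt_one (by positivity) (by linarith)
  -- This bounds `j.choose D * p ^ D / 2` from below: `j + 1 - D ≥ s / 2` and `s p / 2 ≥ ε (v p) /
  -- 16 ≥ ε ^ 2 / 32`.
  set c : ℝ := (ε ^ 2 / 32) ^ D / D.factorial / 2 with hcdef
  have hc0 : 0 < c := by positivity
  have hc2 : c ≤ 1 / 2 := by
    have h1 : (ε ^ 2 / 32) ^ D ≤ 1 := pow_le_one₀ (by positivity) (by nlinarith)
    have h2 : (1 : ℝ) ≤ D.factorial := by exact_mod_cast D.factorial_pos
    have h3 : (ε ^ 2 / 32) ^ D / D.factorial ≤ 1 := by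
      rw [div_le_one (by positivity)]; linarith
    linarith
  set K : ℝ := 2 * ∑ ℓ : Fin k, (1 / c) ^ ((ℓ : ℕ) + 1) with hK
  refine ⟨fun v => v * (1 - c) ^ v + (1 / 2) ^ v + K / v, ?_, ?_⟩
  · have h1 : Tendsto (fun v : ℕ => (v : ℝ) * (1 - c) ^ v) atTop (𝓝 0) :=
      tendsto_self_mul_const_pow_of_lt_one (by linarith) (by linarith)
    have h2 : Tendsto (fun v : ℕ => (1 / 2 : ℝ) ^ v) atTop (𝓝 0) :=
      tendsto_pow_atTop_nhds_zero_of_lt_one (by norm_num) (by norm_num)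
    have h3 : Tendsto (fun v : ℕ => K / v) atTop (𝓝 0) := tendsto_const_div_atTop_nhds_zero_nat K
    simpa using (h1.add h2).add h3
  have hlarge : ∀ᶠ v : ℕ in atTop, 8 ≤ ε * v ∧ 16 * (D : ℝ) ≤ ε * v ∧ 8 * k ≤ v := by
    have ht : Tendsto (fun v : ℕ => ε * (v : ℝ)) atTop atTop :=
      tendsto_natCast_atTop_atTop.const_mul_atTop hε
    exact (ht.eventually_ge_atTop _).and ((ht.eventually_ge_atTop _).and (eventually_ge_atTop _))
  filter_upwards [hlarge] with v ⟨hv8, hvD, hvk⟩ n p hvn hpv hpv'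
  have hp0 : (0 : ℝ) ≤ p := p.2.1
  have hv0 : 0 < v := by omega
  have hvR : (0 : ℝ) < v := by exact_mod_cast hv0
  have : NeZero n := ⟨by nlinarith⟩
  set s := ⌊ε * v / 4⌋₊ with hs
  have hs1 : (s : ℝ) ≤ ε * v / 4 := Nat.floor_le (by positivity)
  have hs2 : ε * v / 8 ≤ s := by
    have := Nat.lt_floor_add_one (ε * v / 4)
    linarith
  have hs0 : 0 < s := by
    have : (0 : ℝ) < s := by linarith
    exact_mod_cast this
  have h2D : 2 * D ≤ s := by
    have : (2 * D : ℝ) ≤ s := by linarith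
    exact_mod_cast this
  refine (binomialRandom_real_not_hasGoodSubgraph_le (c := c) (D := D) (s := s)
    (distinctBlocks_fin hvn) hε.le hk hkε hvk hv0 hs0 (by linarith) (by linarith) hc0 hc2 ?_).trans ?_
  · intro j hsj hjv
    have h1 := Nat.pow_le_choose (α := ℝ) D j
    have h2 : (s : ℝ) / 2 ≤ ((j + 1 - D : ℕ) : ℝ) := by
      have : s ≤ 2 * (j + 1 - D) := by omega
      have : (s : ℝ) ≤ 2 * ((j + 1 - D : ℕ) : ℝ) := by exact_mod_cast this
      linarith
    have h3 : ε ^ 2 / 32 ≤ s / 2 * p := by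
      have : ε * (v * p) / 8 ≤ s * p := by nlinarith
      nlinarith
    rw [hcdef]
    refine div_le_div_of_nonneg_right ?_ (by norm_num)
    calc (ε ^ 2 / 32) ^ D / D.factorial ≤ (((j + 1 - D : ℕ) : ℝ) * p) ^ D / D.factorial := by
          refine div_le_div_of_nonneg_right (pow_le_pow_left₀ (by positivity) ?_ D) (by positivity)
          exact h3.trans (mul_le_mul_of_nonneg_right h2 hp0)
      _ = ((j + 1 - D : ℕ) : ℝ) ^ D / D.factorial * (p : ℝ) ^ D := by rw [mul_pow]; ring
      _ ≤ _ := mul_le_mul_of_nonneg_right h1 (by positivity)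
  · have hsv : ε / 8 ≤ s / v := by
      rw [le_div_iff₀ hvR]; linarith
    have hsv1 : (s : ℝ) / v ≤ 1 := by
      rw [div_le_one hvR]; nlinarith
    have hτ : 2 * (1 - s / v : ℝ) ^ D ≤ (1 / 8) ^ N := by
      have : (1 - s / v : ℝ) ^ D ≤ (1 - ε / 8) ^ D :=
        pow_le_pow_left₀ (by linarith) (by linarith) D
      linarith
    have hτ0 : 0 ≤ 2 * (1 - s / v : ℝ) ^ D := by
      have : (0 : ℝ) ≤ 1 - s / v := by linarith
      positivity
    have hNs : v ≤ N * s := by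
      have h1 : 8 / ε ≤ N := Nat.le_ceil _
      have h2 : (v : ℝ) ≤ N * s := by
        calc (v : ℝ) = 8 / ε * (ε * v / 8) := by field_simp
          _ ≤ N * s := mul_le_mul h1 hs2 (by positivity) (by positivity)
      exact_mod_cast h2
    have hmid : 4 ^ v * (2 * (1 - s / v : ℝ) ^ D) ^ s ≤ (1 / 2 : ℝ) ^ v := by
      calc 4 ^ v * (2 * (1 - s / v : ℝ) ^ D) ^ s ≤ 4 ^ v * ((1 / 8 : ℝ) ^ N) ^ s :=
            mul_le_mul_of_nonneg_left (pow_le_pow_left₀ hτ0 hτ s) (by positivity)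
        _ = 4 ^ v * (1 / 8 : ℝ) ^ (N * s) := by rw [pow_mul]
        _ ≤ 4 ^ v * (1 / 8 : ℝ) ^ v := mul_le_mul_of_nonneg_left
            (pow_le_pow_of_le_one (by norm_num) (by norm_num) hNs) (by positivity)
        _ = (1 / 2 : ℝ) ^ v := by rw [← mul_pow]; norm_num
    linarith

end Limit

end SimpleGraph

theorem proposition2p1 (k : ℕ) (ε : ℝ) (hε : 0 < ε) (p : ℕ → unitInterval)
    (hp_lower : (fun n : ℕ => (n : ℝ) ^ (-(1 / 2) : ℝ)) =o[atTop] fun n : ℕ => (p n : ℝ))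
    (hp_upper : Tendsto (fun n : ℕ => (p n : ℝ)) atTop (𝓝 0)) :
    Tendsto
      (fun n : ℕ => SimpleGraph.binomialRandom (Fin n) (p n)
        {Γ : SimpleGraph (Fin n) | ∃ G : Γ.Subgraph,
          (G.verts.ncard : ℝ) ≤ ε / (p n : ℝ) ∧
          (k : ℕ∞) ≤ G.coe.chromaticNumber ∧
          (k : ℕ∞) ≤ G.coe.egirth ∧
          ∀ A B : Set (Fin n), A ⊆ G.verts → B ⊆ G.verts → Disjoint A B →
            ε * (G.verts.ncard : ℝ) ≤ (A.ncard : ℝ) →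
            ε * (G.verts.ncard : ℝ) ≤ (B.ncard : ℝ) →
            ∃ a ∈ A, ∃ b ∈ B, G.Adj a b})
      atTop (𝓝 1) := by
  -- Decreasing `ε` and increasing `k` only strengthens the conclusion; `k + 1` also covers `k = 0`.
  set δ : ℝ := min ε (1 / (4 * ((k + 1 : ℕ) : ℝ))) with hδ
  have hδ0 : 0 < δ := lt_min hε (by positivity)
  have hδε : δ ≤ ε := min_le_left _ _
  have hkδ : 4 * ((k + 1 : ℕ) : ℝ) * δ ≤ 1 := by
    have h : δ ≤ 1 / (4 * ((k + 1 : ℕ) : ℝ)) := min_le_right _ _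
    rwa [le_div_iff₀ (by positivity), mul_comm] at h
  have hδ1 : δ ≤ 1 := by
    have : (0 : ℝ) ≤ k := by positivity
    push_cast at hkδ
    nlinarith
  obtain ⟨err, herr, hbound⟩ :=
    SimpleGraph.exists_tendsto_zero_binomialRandom_real_le k.succ_pos hδ0 hkδ
  have hlow : ∀ᶠ n : ℕ in atTop, 0 < n ∧ 0 < (p n : ℝ) ∧ (n : ℝ) ^ (-(1 / 2) : ℝ) ≤ p n := by
    filter_upwards [hp_lower.bound (c := 1) one_pos, eventually_gt_atTop 0] with n h hn
    have hn' : (0 : ℝ) < n := by exact_mod_cast hn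
    have h1 : (0 : ℝ) < (n : ℝ) ^ (-(1 / 2) : ℝ) := Real.rpow_pos_of_pos hn' _
    rw [Real.norm_of_nonneg h1.le, Real.norm_of_nonneg (p n).2.1, one_mul] at h
    exact ⟨hn, h1.trans_le h, h⟩
  let v : ℕ → ℕ := fun n => ⌊δ / (p n : ℝ)⌋₊
  have hv : Tendsto v atTop atTop := by
    refine tendsto_nat_floor_atTop.comp ?_
    have hinv : Tendsto (fun n : ℕ => ((p n : ℝ))⁻¹) atTop atTop := by
      refine tendsto_inv_nhdsGT_zero.comp (tendsto_nhdsWithin_iff.2 ⟨hp_upper, ?_⟩)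
      filter_upwards [hlow] with n h using h.2.1
    simpa only [div_eq_mul_inv] using hinv.const_mul_atTop hδ0
  have hmain : Tendsto (fun n : ℕ => (SimpleGraph.binomialRandom (Fin n) (p n)).real
      {Γ : SimpleGraph (Fin n) | Γ.HasGoodSubgraph (v n) (k + 1) δ}) atTop (𝓝 1) := by
    have hlim : Tendsto (fun n => 1 - err (v n)) atTop (𝓝 1) := by
      simpa using (herr.comp hv).const_sub 1
    refine tendsto_of_tendsto_of_tendsto_of_le_of_le' hlim tendsto_const_nhds ?_
      (Eventually.of_forall fun n => measureReal_le_one)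
    filter_upwards [hlow, hv.eventually hbound, hp_upper.eventually (ge_mem_nhds
      (show (0 : ℝ) < δ / 2 by positivity))] with n ⟨hn, hp, hpn⟩ hb hpδ
    have hvp : (v n : ℝ) ≤ δ / p n := Nat.floor_le (by positivity)
    have hvp' : δ / p n < v n + 1 := Nat.lt_floor_add_one _
    have h1 : v n * (p n : ℝ) ≤ δ := by rwa [le_div_iff₀ hp] at hvp
    -- Rounding down loses at most `p n ≤ δ / 2`.
    have h2 : δ / 2 ≤ v n * (p n : ℝ) := by
      rw [div_lt_iff₀ hp] at hvp'
      linarith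
    have hn' : (0 : ℝ) < n := by exact_mod_cast hn
    have h3 : v n * v n ≤ n := by
      have h4 : (v n : ℝ) ≤ (n : ℝ) ^ (1 / 2 : ℝ) := by
        rw [Real.rpow_neg hn'.le] at hpn
        have hr : (0 : ℝ) < (n : ℝ) ^ (1 / 2 : ℝ) := Real.rpow_pos_of_pos hn' _
        have h5 : 1 ≤ p n * (n : ℝ) ^ (1 / 2 : ℝ) := by
          rwa [inv_le_iff_one_le_mul₀ hr] at hpn
        refine le_of_mul_le_mul_right ?_ hp
        linarith
      have h6 : (v n * v n : ℝ) ≤ n := by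
        calc (v n * v n : ℝ) ≤ (n : ℝ) ^ (1 / 2 : ℝ) * (n : ℝ) ^ (1 / 2 : ℝ) :=
              mul_le_mul h4 h4 (by positivity) (by positivity)
          _ = n := by rw [← Real.rpow_add hn']; norm_num
      exact_mod_cast h6
    have h7 := hb n (p n) h3 h1 h2
    have h8 := probReal_compl_eq_one_sub (μ := SimpleGraph.binomialRandom (Fin n) (p n))
      (s := {Γ | Γ.HasGoodSubgraph (v n) (k + 1) δ}) .of_discrete
    have h9 : {Γ : SimpleGraph (Fin n) | ¬ Γ.HasGoodSubgraph (v n) (k + 1) δ} =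
      {Γ | Γ.HasGoodSubgraph (v n) (k + 1) δ}ᶜ := rfl
    rw [h9, h8] at h7
    linarith
  have hmain' : Tendsto (fun n : ℕ => SimpleGraph.binomialRandom (Fin n) (p n)
      {Γ : SimpleGraph (Fin n) | Γ.HasGoodSubgraph (v n) (k + 1) δ}) atTop (𝓝 1) := by
    rw [← ENNReal.tendsto_toReal_iff (fun _ => measure_ne_top _ _) ENNReal.one_ne_top]
    simpa [measureReal_def] using hmain
  refine tendsto_of_tendsto_of_tendsto_of_le_of_le' hmain' tendsto_const_nhds ?_
    (Eventually.of_forall fun n => prob_le_one)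
  filter_upwards [hlow] with n ⟨_, hp, _⟩
  refine measure_mono ?_
  rintro Γ ⟨G, hG, hχ, hg, hAB⟩
  have hk : (k : ℕ∞) ≤ ((k + 1 : ℕ) : ℕ∞) := by exact_mod_cast k.le_succ
  have hδG : δ * (G.verts.ncard : ℝ) ≤ ε * G.verts.ncard :=
    mul_le_mul_of_nonneg_right hδε (by positivity)
  refine ⟨G, ?_, hk.trans hχ, hk.trans hg, fun A B hA hB hd hAc hBc =>
    hAB A B hA hB hd (hδG.trans hAc) (hδG.trans hBc)⟩
  calc (G.verts.ncard : ℝ) ≤ v n := by exact_mod_cast hG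
    _ ≤ δ / p n := Nat.floor_le (by positivity)
    _ ≤ ε / p n := div_le_div_of_nonneg_right hδε hp.le
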